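/- **Setting.** Let $\Omega\subset\mathbb R^d$ be a bounded open set and $k\ge 0$ an integer. Let $\mathcal X$ be a real Hilbert space of functions on $\Omega$ (functions agreeing a.e. on $\Omega$ are identified) that contains the restrictions to $\Omega$ of all $C^k$ functions on $\mathbb R^d$, with $\|v\|_{\mathcal X}\le C\max_{j\le k}\sup_\Omega|D^jv|$ for these; for instance a Sobolev space $H^k(\Omega)$, possibly with bounded weights. Let $\mathcal V,\mathcal W$ be Hilbert spaces and let $\mathcal L:\mathcal X\to\mathcal V$, $\mathcal B:\mathcal X\to\mathcal W$ be bounded linear operators such that for all $f\in\mathcal V$, $g\in\mathcal W$ the problem $\mathcal L u=f$, $\mathcal B u=g$ has a unique solution $u\in\mathcal X$, and $\|u\|_{\mathcal X}\le C(\|f\|_{\mathcal V}+\|g\|_{\mathcal W})$ with $C$ independent of $f,g$. For $\delta\ge1$ put $$a(u,v)=(\mathcal Lu,\mathcal Lv)_{\mathcal V}+\delta(\mathcal Bu,\mathcal Bv)_{\mathcal W},\quad F(v)=(f,\mathcal Lv)_{\mathcal V}+\delta(g,\mathcal Bv)_{\mathcal W},\quad |||v|||=a(v,v)^{1/2},$$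 and $\langle r(w),v\rangle=F(v)-a(w,v)$. Let $u\in\mathcal X$ satisfy $a(u,v)=F(v)$ for all $v\in\mathcal X$. *Networks.* Let $\sigma\in C^k(\mathbb R)$ not be a polynomial. For $L\ge1$, $\mathbf n\in\mathbb N^L$ and $C>0$, let $V^{\sigma,C}_{\mathbf n,L}$ be the set of functions $x\mapsto(\sigma\circ T_L\circ\dots\circ\sigma\circ T_1(x))\cdot\mathbf c$ with $T_j(t)=tW^{(j)}+b^{(j)}$, where layer $j$ has width $n_j$ and $\sum_{j=1}^L(\|W^{(j)}\|_\infty+\|b^{(j)}\|_\infty)+\|\mathbf c\|_\infty\le C$ ($\|\cdot\|_\infty$ is the maximal absolute value of the entries). *Knowledge-based functions.* Let $\Psi:\Omega\times\mathbb R\to\mathbb R$, $\mathcal M\in\mathbb N$ and $\lambda\in\mathbb R^{\mathcal M}$ with $\Psi(\cdot;\lambda_j)\in\mathcal X$ for all $j$. Let $V^\Psi_{\mathcal M}(\lambda)$ be the set of all $\sum_{j=1}^{\mathcal M}d_j\Psi(\cdot;\lambda_j)$, $\mathbf d\in\mathbb R^{\mathcal M}$, and $V^{\Psi,C}_{\mathcal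 M}(\lambda)$ the subset with $\|\mathbf d\|_\infty+\|\lambda\|_\infty\le C$. *Solution structure.* Suppose $u=u_\infty+u_\Psi$, where $u_\Psi\in V^\Psi_{\mathcal M}(\lambda)$ and the regular part $u_\infty$ lies in the closure in $\mathcal X$ of the $C^k$ functions. *Iteration.* Let $u_0=u_{\sigma,0}+u_{\Psi,0}$ with $u_{\sigma,0}$ in the same closure and $u_{\Psi,0}\in V^\Psi_{\mathcal M}(\lambda)$. For given depth $L_i$, widths $\mathbf n^{(i)}$ and bounds $C_1,C_2$ (which may be different for different $i\geq 1$), let $\varphi_i^{NN}=\varphi_{\sigma,i}^{NN}+\varphi_{\Psi,i}^{NN}$ be a maximizer of $v\mapsto\langle r(u_{i-1}),v\rangle$ over all $v\in V^{\sigma,C_1}_{\mathbf n^{(i)},L_i}+V^{\Psi,C_2}_{\mathcal M}(\lambda)$ with $|||v|||=1$, where $\varphi_{\sigma,i}^{NN}$ and $\varphi_{\Psi,i}^{NN}$ belong to the first and the second summand. The next iterate is $u_i=u_{\sigma,i}+u_{\Psi,i}$, with $u_{\sigma,i}\in\mathrm{span}\{u_{\sigma,0}/|||u_0|||,\varphi_{\sigma,1}^{NN},\dots,\varphi_{\sigma,i}^{NN}\}$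 and $u_{\Psi,i}\in\mathrm{span}\{u_{\Psi,0}/|||u_0|||,\varphi_{\Psi,1}^{NN},\dots,\varphi_{\Psi,i}^{NN}\}$ (these generators being read as $0$ when $u_0=0$), such that $a(u_i,v)=F(v)$ for all $v$ in the sum of the two spans. **Proposition.** For every $\varepsilon>0$ and every depth $L_i\ge1$ there are widths $\mathbf n^{(i)}\in\mathbb N^{L_i}$ and $C_1>0$, depending (for fixed $\Omega,\mathcal X,\mathcal L,\mathcal B,\delta,\sigma,\Psi,\mathcal M,\lambda,L_i$) only on $\varepsilon$ and $u_\infty-u_{\sigma,i-1}$, and $C_2>0$, depending only on $\varepsilon$ and $u_\Psi-u_{\Psi,i-1}$, with the following property. If $u\ne u_{i-1}$, then with these choices a maximizer $\varphi_i^{NN}$ exists, and every such maximizer satisfies $$|||\varphi_i-\varphi_i^{NN}|||\le\varepsilon,\qquad \varphi_i:=\frac{u-u_{i-1}}{|||u-u_{i-1}|||}.$$ -/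

import Mathlib

open MeasureTheory

namespace XGNN

noncomputable section

/-! ### The function space and the least squares problem -/

/-- Data making the Hilbert space `X` a space of real functions on `Ω ⊆ ℝ^d` (functions are
identified when they agree almost everywhere on `Ω`), of order at most `k`: restrictions to `Ω`
of `C^k` functions belong to `X`, and their norm in `X` is controlled by the `C^k` norm on `Ω`.
For bounded `Ω`, the Sobolev space `H^k(Ω)`, and its versions with bounded weights, are of this
kind. -/
structure FunctionSpace {d : ℕ} (Ω : Set (EuclideanSpace ℝ (Fin d))) (k : ℕ)
    (X : Type*) [NormedAddCommGroup X] [InnerProductSpace ℝ X] where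
  /-- The function that an element of `X` is. -/
  toFun : X →ₗ[ℝ] (EuclideanSpace ℝ (Fin d) →ₘ[volume.restrict Ω] ℝ)
  injective : Function.Injective toFun
  exists_of_contDiff : ∀ f : EuclideanSpace ℝ (Fin d) → ℝ, ContDiff ℝ k f →
    ∃ v : X, toFun v =ᵐ[volume.restrict Ω] f
  exists_norm_le : ∃ C : ℝ, ∀ (v : X) (f : EuclideanSpace ℝ (Fin d) → ℝ), ContDiff ℝ k f →
    toFun v =ᵐ[volume.restrict Ω] f → ∀ R : ℝ, 0 ≤ R →
      (∀ j ≤ k, ∀ x ∈ Ω, ‖iteratedFDeriv ℝ j f x‖ ≤ R) → ‖v‖ ≤ C * R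

section LeastSquares

variable {X V W : Type*} [NormedAddCommGroup X] [InnerProductSpace ℝ X]
  [NormedAddCommGroup V] [InnerProductSpace ℝ V] [NormedAddCommGroup W] [InnerProductSpace ℝ W]

/-- Well-posedness of `𝓛 u = f`, `𝓑 u = g`: for all data there is a unique solution, and it
depends continuously on the data. -/
def WellPosed (𝓛 : X →L[ℝ] V) (𝓑 : X →L[ℝ] W) : Prop :=
  ∃ C : ℝ, 0 < C ∧ ∀ (f : V) (g : W), ∃ u : X, 𝓛 u = f ∧ 𝓑 u = g ∧
    (∀ w : X, 𝓛 w = f → 𝓑 w = g → w = u) ∧ ‖u‖ ≤ C * (‖f‖ + ‖g‖)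

/-- The least squares bilinear form `a(u, v) = (𝓛 u, 𝓛 v) + δ (𝓑 u, 𝓑 v)`. -/
def lsForm (𝓛 : X →L[ℝ] V) (𝓑 : X →L[ℝ] W) (δ : ℝ) (u v : X) : ℝ :=
  inner ℝ (𝓛 u) (𝓛 v) + δ * inner ℝ (𝓑 u) (𝓑 v)

/-- The least squares linear form `F(v) = (f, 𝓛 v) + δ (g, 𝓑 v)`. -/
def lsFunctional (𝓛 : X →L[ℝ] V) (𝓑 : X →L[ℝ] W) (δ : ℝ) (f : V) (g : W) (v : X) : ℝ :=
  inner ℝ f (𝓛 v) + δ * inner ℝ g (𝓑 v)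

end LeastSquares

/-- The energy norm `|||v||| = a(v, v)^{1/2}`. -/
def energyNorm {X : Type*} (a : X → X → ℝ) (v : X) : ℝ := Real.sqrt (a v v)

/-- The weak residual `⟨r(w), v⟩ = F(v) - a(w, v)`. -/
def residual {X : Type*} (a : X → X → ℝ) (F : X → ℝ) (w v : X) : ℝ := F v - a w v

/-! ### Feedforward networks -/

/-- Parameters of a feedforward network with input dimension `m` and hidden layer widths given by
a list, whose length is the depth: one weight matrix `W` and one bias `b` per hidden layer, and
finally the output coefficients `c`. -/
inductive Network : ℕ → List ℕ → Type
  | output {m : ℕ} (c : Fin m → ℝ) : Network m []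
  | layer {m p : ℕ} {l : List ℕ} (W : Fin m → Fin p → ℝ) (b : Fin p → ℝ) (N : Network p l) :
      Network m (p :: l)

/-- The realization `t ↦ (σ ∘ T_L ∘ ⋯ ∘ σ ∘ T_1) (t) · c`, `T_j t = t W_j + b_j`. -/
def Network.eval (σ : ℝ → ℝ) : {m : ℕ} → {l : List ℕ} → Network m l → (Fin m → ℝ) → ℝ
  | _, _, .output c, t => ∑ i, t i * c i
  | _, _, .layer W b N, t => N.eval σ (fun q => σ (∑ i, t i * W i q + b q))

/-- The size `∑_j (‖W_j‖_∞ + ‖b_j‖_∞) + ‖c‖_∞` of the parameters; all norms are maxima of the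
absolute values of the entries. -/
def Network.size : {m : ℕ} → {l : List ℕ} → Network m l → ℝ
  | _, _, .output c => ‖c‖
  | _, _, .layer W b N => ‖W‖ + ‖b‖ + N.size

/-! ### Approximation sets in `X` -/

namespace FunctionSpace

variable {d : ℕ} {Ω : Set (EuclideanSpace ℝ (Fin d))} {k : ℕ}
  {X : Type*} [NormedAddCommGroup X] [InnerProductSpace ℝ X]

/-- The element `v` of `X` is the function `f` on `Ω`. -/
def Represents (S : FunctionSpace Ω k X) (v : X) (f : EuclideanSpace ℝ (Fin d) → ℝ) : Prop :=
  S.toFun v =ᵐ[volume.restrict Ω] f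

/-- The elements of `X` that are limits in `X` of `C^k` functions. -/
def regularPart (S : FunctionSpace Ω k X) : Set X :=
  closure {v | ∃ f : EuclideanSpace ℝ (Fin d) → ℝ, ContDiff ℝ k f ∧ S.Represents v f}

/-- Networks of widths `n` with activation `σ` and parameters bounded by `C`. -/
def networkSet (S : FunctionSpace Ω k X) (σ : ℝ → ℝ) (n : List ℕ) (C : ℝ) : Set X :=
  {v | ∃ N : Network d n, N.size ≤ C ∧ S.Represents v (fun x => N.eval σ (fun i => x i))}

/-- The parameters `μ` for which `Ψ(·; μ)` belongs to `X`. -/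
def admissible (S : FunctionSpace Ω k X) (Ψ : EuclideanSpace ℝ (Fin d) → ℝ → ℝ) : Set ℝ :=
  {μ | ∃ v : X, S.Represents v (fun x => Ψ x μ)}

/-- The knowledge-based space of all `∑_j c_j Ψ(·; lam_j)`. -/
def knowledgeSet (S : FunctionSpace Ω k X) (Ψ : EuclideanSpace ℝ (Fin d) → ℝ → ℝ) {M : ℕ}
    (lam : Fin M → ℝ) : Set X :=
  {v | ∃ c : Fin M → ℝ, S.Represents v (fun x => ∑ j, c j * Ψ x (lam j))}

/-- The functions `∑_j c_j Ψ(·; lam_j)` with `‖c‖_∞ + ‖lam‖_∞ ≤ C`. -/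
def knowledgeSetBounded (S : FunctionSpace Ω k X) (Ψ : EuclideanSpace ℝ (Fin d) → ℝ → ℝ) {M : ℕ}
    (lam : Fin M → ℝ) (C : ℝ) : Set X :=
  {v | ∃ c : Fin M → ℝ, ‖c‖ + ‖lam‖ ≤ C ∧ S.Represents v (fun x => ∑ j, c j * Ψ x (lam j))}

end FunctionSpace

/-! ### The extended Galerkin neural network iteration -/

section Iteration

variable {X : Type*} [NormedAddCommGroup X] [InnerProductSpace ℝ X]

/-- `p + q`, with `p ∈ A` and `q ∈ B`, maximizes the residual `⟨r(w), ·⟩` over the elements of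
`A + B` of energy norm one. -/
def IsBasisFunction (a : X → X → ℝ) (F : X → ℝ) (w : X) (A B : Set X) (p q : X) : Prop :=
  p ∈ A ∧ q ∈ B ∧ energyNorm a (p + q) = 1 ∧
    ∀ p' ∈ A, ∀ q' ∈ B, energyNorm a (p' + q') = 1 →
      residual a F w (p' + q') ≤ residual a F w (p + q)

/-- The span of `v₀ / |||u₀|||` and `φ 1, …, φ j`. -/
def partSpan (a : X → X → ℝ) (u₀ v₀ : X) (φ : ℕ → X) (j : ℕ) : Submodule ℝ X :=
  Submodule.span ℝ (insert ((energyNorm a u₀)⁻¹ • v₀) (φ '' Set.Icc 1 j))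

variable {d : ℕ} {Ω : Set (EuclideanSpace ℝ (Fin d))} {k : ℕ}

/-- `uσ j + uΨ j`, `j = 0, …, i`, are the first iterates of the extended Galerkin neural network
method for `a(u, ·) = F`, with basis functions `φσ j + φΨ j`, `j = 1, …, i`. Depths, widths and
parameter bounds may be different in each step. -/
structure IsIteration (S : FunctionSpace Ω k X) (a : X → X → ℝ) (F : X → ℝ) (σ : ℝ → ℝ)
    (Ψ : EuclideanSpace ℝ (Fin d) → ℝ → ℝ) {M : ℕ} (lam : Fin M → ℝ)
    (φσ φΨ uσ uΨ : ℕ → X) (i : ℕ) : Prop where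
  regular_zero : uσ 0 ∈ S.regularPart
  singular_zero : uΨ 0 ∈ S.knowledgeSet Ψ lam
  isBasisFunction : ∀ j < i, ∃ (n : List ℕ) (C₁ C₂ : ℝ), n ≠ [] ∧
    IsBasisFunction a F (uσ j + uΨ j) (S.networkSet σ n C₁) (S.knowledgeSetBounded Ψ lam C₂)
      (φσ (j + 1)) (φΨ (j + 1))
  regular_mem : ∀ j, 1 ≤ j → j ≤ i → uσ j ∈ partSpan a (uσ 0 + uΨ 0) (uσ 0) φσ j
  singular_mem : ∀ j, 1 ≤ j → j ≤ i → uΨ j ∈ partSpan a (uσ 0 + uΨ 0) (uΨ 0) φΨ j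
  galerkin : ∀ j, 1 ≤ j → j ≤ i →
    ∀ v ∈ partSpan a (uσ 0 + uΨ 0) (uσ 0) φσ j ⊔ partSpan a (uσ 0 + uΨ 0) (uΨ 0) φΨ j,
      a (uσ j + uΨ j) v = F v

end Iteration

end

end XGNN

/-! The map `T x = (𝓛 x, √δ 𝓑 x)` turns the energy norm into `‖T x‖`, and well-posedness bounds
`‖x‖` by a multiple of it. If `v` has energy norm one, its squared distance to the normalized error
is 2 minus a positive multiple of the residual at `v`. So a maximizer of the residual is a best
approximation of the normalized error among the admissible unit elements
(`IsBasisFunction.energyNorm_sub_le`). Maximizers exist because both parameter sets are compact and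
map continuously to `X`. It remains to find one admissible unit element within `ε` of the normalized
error.

The difficulty is the dependence of the bounds. The parts `e₁` and `e₂` of the error may almost
cancel, and then dividing them by the norm of `e₁ + e₂` gives arbitrarily large summands.
`exists_stable_decomposition` removes from `e₁` its component in the intersection of the knowledge
space with the closed regular part. The new first summand `e` still depends on `e₁` alone, but is
now bounded by `‖e₁ + e₂‖`. A network is fitted to the direction of `e` before `e₂` is known and is
only rescaled afterwards, by a bounded factor. The coefficients of the knowledge part are then
bounded by a constant independent of the error and of `ε`.

Density of networks in `C^k` on bounded sets goes through ridge functions. Mollifications of `σ` are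
limits of combinations of translates of `σ`. If `σ` is not a polynomial, for each `m` some
mollification has a nonzero `m`-th derivative somewhere, and Taylor expansion of its dilates yields
`t ^ m`. Monomials yield `exp`, hence exponentials of linear forms, and convolution with a peaked
exponential polynomial reaches every `C^k` function. Further layers are gained by composing with a
shallow network close to the identity. -/

namespace XGNN

open Metric Set Filter Topology

/-! ### Approximation in `C^k` on bounded sets -/

section CkClosure

variable {E F : Type*} [NormedAddCommGroup E] [NormedSpace ℝ E]
  [NormedAddCommGroup F] [NormedSpace ℝ F]

/-- The `C^k` functions that can be approximated, together with their derivatives up to order `k`,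
uniformly on bounded sets by `C^k` functions from `G`. -/
def ckClosure (k : ℕ) (G : Submodule ℝ (E → ℝ)) : Submodule ℝ (E → ℝ) where
  carrier := {f | ContDiff ℝ k f ∧ ∀ ρ ε : ℝ, 0 < ε → ∃ g ∈ G, ContDiff ℝ k g ∧
    ∀ j ≤ k, ∀ x ∈ ball (0 : E) ρ, ‖iteratedFDeriv ℝ j (f - g) x‖ ≤ ε}
  zero_mem' := ⟨contDiff_const, fun ρ ε hε => ⟨0, G.zero_mem, contDiff_const, fun j _ x _ => by
    simp [hε.le]⟩⟩
  add_mem' := by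
    rintro f₁ f₂ ⟨h₁, a₁⟩ ⟨h₂, a₂⟩
    refine ⟨ContDiff.add h₁ h₂, fun ρ ε hε => ?_⟩
    obtain ⟨g₁, hg₁, c₁, b₁⟩ := a₁ ρ (ε / 2) (half_pos hε)
    obtain ⟨g₂, hg₂, c₂, b₂⟩ := a₂ ρ (ε / 2) (half_pos hε)
    refine ⟨g₁ + g₂, G.add_mem hg₁ hg₂, c₁.add c₂, fun j hj x hx => ?_⟩
    have hjk : (j : WithTop ℕ∞) ≤ k := by exact_mod_cast hj
    rw [add_sub_add_comm, iteratedFDeriv_add_apply (f := f₁ - g₁) (g := f₂ - g₂)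
      ((h₁.sub c₁).of_le hjk).contDiffAt ((h₂.sub c₂).of_le hjk).contDiffAt]
    refine (norm_add_le _ _).trans ?_
    linarith [b₁ j hj x hx, b₂ j hj x hx]
  smul_mem' := by
    rintro c f ⟨h, a⟩
    refine ⟨contDiff_const.smul h, fun ρ ε hε => ?_⟩
    obtain ⟨g, hg, cg, b⟩ := a ρ (ε / (|c| + 1)) (by positivity)
    refine ⟨c • g, G.smul_mem c hg, contDiff_const.smul cg, fun j hj x hx => ?_⟩
    have hjk : (j : WithTop ℕ∞) ≤ k := by exact_mod_cast hj
    rw [← smul_sub, iteratedFDeriv_const_smul_apply (f := f - g) ((h.sub cg).of_le hjk).contDiffAt, norm_smul,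
      Real.norm_eq_abs]
    calc |c| * ‖iteratedFDeriv ℝ j (f - g) x‖ ≤ (|c| + 1) * (ε / (|c| + 1)) := by
          gcongr
          · linarith
          · exact b j hj x hx
      _ = ε := by field_simp

variable {k : ℕ} {G : Submodule ℝ (E → ℝ)}

theorem mem_ckClosure_of_mem {g : E → ℝ} (hg : g ∈ G) (h : ContDiff ℝ k g) :
    g ∈ ckClosure k G :=
  ⟨h, fun ρ ε hε => ⟨g, hg, h, fun j _ x _ => by
    simp [hε.le]⟩⟩

/-- The `C^k` closure is closed. -/
theorem mem_ckClosure_of_approx {f : E → ℝ} (hf : ContDiff ℝ k f)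
    (h : ∀ ρ ε : ℝ, 0 < ρ → 0 < ε → ∃ g ∈ ckClosure k G,
      ∀ j ≤ k, ∀ x ∈ ball (0 : E) ρ, ‖iteratedFDeriv ℝ j (f - g) x‖ ≤ ε) :
    f ∈ ckClosure k G := by
  refine ⟨hf, fun ρ ε hε => ?_⟩
  obtain ⟨g, ⟨cg, ag⟩, b⟩ := h (max ρ 1) (ε / 2) (by positivity) (half_pos hε)
  obtain ⟨g', hg', cg', b'⟩ := ag ρ (ε / 2) (half_pos hε)
  refine ⟨g', hg', cg', fun j hj x hx => ?_⟩
  have hjk : (j : WithTop ℕ∞) ≤ k := by exact_mod_cast hj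
  rw [← sub_add_sub_cancel f g g', iteratedFDeriv_add_apply (f := f - g) (g := g - g')
    ((hf.sub cg).of_le hjk).contDiffAt ((cg.sub cg').of_le hjk).contDiffAt]
  refine (norm_add_le _ _).trans ?_
  linarith [b j hj x (ball_subset_ball (le_max_left _ _) hx), b' j hj x hx]

theorem ckClosure_le_of_le {G' : Submodule ℝ (E → ℝ)} (h : G ≤ ckClosure k G') :
    ckClosure k G ≤ ckClosure k G' := by
  rintro f ⟨hf, a⟩
  refine mem_ckClosure_of_approx hf fun ρ ε _ hε => ?_
  obtain ⟨g, hg, -, b⟩ := a ρ ε hε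
  exact ⟨g, h hg, b⟩

/-- Substitution of an affine map is compatible with `C^k` approximation. -/
theorem comp_affine_mem_ckClosure {H : Submodule ℝ (F → ℝ)} (A : E →L[ℝ] F) (b : F)
    (hGH : ∀ g ∈ H, (fun x => g (A x + b)) ∈ G) {f : F → ℝ} (hf : f ∈ ckClosure k H) :
    (fun x => f (A x + b)) ∈ ckClosure k G := by
  obtain ⟨cf, a⟩ := hf
  have hcomp : ∀ {g : F → ℝ}, ContDiff ℝ k g → ContDiff ℝ k fun x => g (A x + b) :=
    fun hg => hg.comp (A.contDiff.add contDiff_const)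
  refine ⟨hcomp cf, fun ρ ε hε => ?_⟩
  -- The radius covers the image of the ball under the affine map. The chain rule costs a factor
  -- `‖A‖ ^ j`, and `(1 + ‖A‖) ^ k` dominates it for all `j ≤ k` at once.
  obtain ⟨g, hg, cg, h⟩ := a (‖A‖ * ρ + ‖b‖ + 1) (ε / (1 + ‖A‖) ^ k) (by positivity)
  refine ⟨_, hGH g hg, hcomp cg, fun j hj x hx => ?_⟩
  have hjk : (j : WithTop ℕ∞) ≤ k := by exact_mod_cast hj
  have e : ((fun x => f (A x + b)) - fun x => g (A x + b)) =
      (fun y => (f - g) (y + b)) ∘ A := rfl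
  have c' : ContDiff ℝ k fun y => (f - g) (y + b) :=
    (cf.sub cg).comp (contDiff_id.add contDiff_const)
  rw [e, A.iteratedFDeriv_comp_right c' x hjk, iteratedFDeriv_comp_add_right]
  refine (ContinuousMultilinearMap.norm_compContinuousLinearMap_le _ _).trans ?_
  have hx' : ‖x‖ < ρ := by simpa using hx
  have hmem : A x + b ∈ ball (0 : F) (‖A‖ * ρ + ‖b‖ + 1) := by
    rw [mem_ball_zero_iff]
    have h1 := A.le_opNorm x
    have h2 : ‖A‖ * ‖x‖ ≤ ‖A‖ * ρ := by gcongr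
    linarith [norm_add_le (A x) b]
  rw [Finset.prod_const, Finset.card_univ, Fintype.card_fin]
  calc _ ≤ ε / (1 + ‖A‖) ^ k * (1 + ‖A‖) ^ k := by
        have h0 := norm_nonneg A
        gcongr
        · exact h j hj _ hmem
        · exact (pow_le_pow_left₀ h0 (by linarith) j).trans
            (pow_le_pow_right₀ (by linarith) hj)
    _ = ε := by field_simp

end CkClosure

/-! ### Averages of translates -/

section Averages

variable {E : Type*} [NormedAddCommGroup E] [NormedSpace ℝ E]

/-- Multiplication by a cutoff function. -/
theorem exists_hasCompactSupport_eq [FiniteDimensional ℝ E] {k : ℕ} {f : E → ℝ} (hf : ContDiff ℝ k f) (ρ : ℝ) :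
    ∃ g : E → ℝ, ContDiff ℝ k g ∧ HasCompactSupport g ∧ ∀ x ∈ ball (0 : E) ρ, g x = f x := by
  have h1 : 0 < max ρ 1 := by positivity
  let χ : ContDiffBump (0 : E) := ⟨max ρ 1, max ρ 1 + 1, h1, by linarith⟩
  refine ⟨fun x => χ x * f x, χ.contDiff.mul hf, χ.hasCompactSupport.mul_right, fun x hx => ?_⟩
  have : χ x = 1 := χ.one_of_mem_closedBall
    (ball_subset_closedBall (ball_subset_ball (le_max_left _ _) hx))
  simp [this]

/-- The derivatives of a compactly supported `C^k` function are bounded. -/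
theorem exists_norm_iteratedFDeriv_le {k : ℕ} {f : E → ℝ} (hf : ContDiff ℝ k f)
    (hc : HasCompactSupport f) : ∃ M : ℝ, 0 < M ∧ ∀ j ≤ k, ∀ x, ‖iteratedFDeriv ℝ j f x‖ ≤ M := by
  have h : ∀ j : ℕ, ∃ C : ℝ, j ≤ k → ∀ x, ‖iteratedFDeriv ℝ j f x‖ ≤ C := fun j => by
    by_cases hj : j ≤ k
    · obtain ⟨C, hC⟩ := (hc.iteratedFDeriv j).exists_bound_of_continuous
        (hf.continuous_iteratedFDeriv (by exact_mod_cast hj))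
      exact ⟨C, fun _ => hC⟩
    · exact ⟨0, fun h => absurd h hj⟩
  choose C hC using h
  refine ⟨∑ j ∈ Finset.range (k + 1), |C j| + 1, by positivity, fun j hj x => ?_⟩
  have h1 : |C j| ≤ ∑ j ∈ Finset.range (k + 1), |C j| :=
    Finset.single_le_sum (f := fun j => |C j|) (fun _ _ => abs_nonneg _)
      (Finset.mem_range.2 (by omega))
  linarith [hC j hj x, le_abs_self (C j)]

/-- The derivatives of a compactly supported `C^k` function are uniformly continuous. -/
theorem exists_norm_iteratedFDeriv_sub_le {k : ℕ} {f : E → ℝ} (hf : ContDiff ℝ k f)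
    (hc : HasCompactSupport f) {η : ℝ} (hη : 0 < η) : ∃ δ : ℝ, 0 < δ ∧ ∀ j ≤ k, ∀ x y,
      ‖x - y‖ ≤ δ → ‖iteratedFDeriv ℝ j f x - iteratedFDeriv ℝ j f y‖ ≤ η := by
  have h : ∀ j ∈ Finset.range (k + 1), ∀ᶠ δ in 𝓝[>] (0 : ℝ), ∀ x y, ‖x - y‖ ≤ δ →
      ‖iteratedFDeriv ℝ j f x - iteratedFDeriv ℝ j f y‖ ≤ η := fun j hj => by
    have hj' : j ≤ k := by simpa [Nat.lt_succ_iff] using hj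
    have hu : UniformContinuous (iteratedFDeriv ℝ j f) :=
      (hc.iteratedFDeriv j).uniformContinuous_of_continuous
        (hf.continuous_iteratedFDeriv (by exact_mod_cast hj'))
    obtain ⟨δ, hδ, h⟩ := Metric.uniformContinuous_iff.1 hu η hη
    filter_upwards [Ioo_mem_nhdsGT hδ] with δ' hδ' x y hxy
    have := h (a := x) (b := y) (by rw [dist_eq_norm]; exact hxy.trans_lt hδ'.2)
    rw [dist_eq_norm] at this
    exact this.le
  obtain ⟨δ, h1, h2⟩ := (((Finset.eventually_all _).2 h).and self_mem_nhdsWithin).exists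
  exact ⟨δ, h2, fun j hj => h1 j (Finset.mem_range.2 (by omega))⟩

/-- Currying the first variable of a multilinear map, as a continuous linear map. -/
noncomputable def curryLeftCLM (E : Type*) [NormedAddCommGroup E] [NormedSpace ℝ E] (m : ℕ) :
    (E [×(m + 1)]→L[ℝ] ℝ) →L[ℝ] (E →L[ℝ] (E [×m]→L[ℝ] ℝ)) :=
  (continuousMultilinearCurryLeftEquiv ℝ
    (fun _ : Fin (m + 1) => E) ℝ).toContinuousLinearEquiv.toContinuousLinearMap

variable [FiniteDimensional ℝ E]
variable [MeasurableSpace E] [BorelSpace E] {α : Type*} [MeasurableSpace α] {μ : Measure α}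

theorem integrable_smul_translate {P : Type*} [NormedAddCommGroup P] [NormedSpace ℝ P] {h : E → P}
    (hcont : Continuous h) {M : ℝ} (hM : ∀ x, ‖h x‖ ≤ M) {κ : α → ℝ} (hκ : Integrable κ μ)
    {r : α → E} (hr : Measurable r) (x : E) : Integrable (fun a => κ a • h (x - r a)) μ :=
  hκ.smul_bdd M (hcont.comp_stronglyMeasurable
    (measurable_const.sub hr).stronglyMeasurable).aestronglyMeasurable
    (Eventually.of_forall fun _ => hM _)

/-- Differentiation of an average of translates; the derivative is given through an auxiliary
space `Q`. -/
theorem hasFDerivAt_integral_translate {P Q : Type*} [NormedAddCommGroup P] [NormedSpace ℝ P]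
    [CompleteSpace P] [NormedAddCommGroup Q] [NormedSpace ℝ Q] [CompleteSpace Q]
    (T : Q →L[ℝ] (E →L[ℝ] P)) {h : E → P} {h' : E → Q}
    (hd : ∀ x, HasFDerivAt h (T (h' x)) x) (hcont : Continuous h) (hcont' : Continuous h')
    {M : ℝ} (hM : ∀ x, ‖h x‖ ≤ M) (hM' : ∀ x, ‖h' x‖ ≤ M) {κ : α → ℝ} (hκ : Integrable κ μ)
    {r : α → E} (hr : Measurable r) (x : E) :
    HasFDerivAt (fun x => ∫ a, κ a • h (x - r a) ∂μ) (T (∫ a, κ a • h' (x - r a) ∂μ)) x := by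
  have hint := integrable_smul_translate (μ := μ) hcont hM hκ hr
  have hint' := integrable_smul_translate (μ := μ) hcont' hM' hκ hr
  rw [← T.integral_comp_comm (hint' x)]
  refine hasFDerivAt_integral_of_dominated_of_fderiv_le
    (F' := fun x a => T (κ a • h' (x - r a)))
    (bound := fun a => ‖T‖ * (M * ‖κ a‖)) (s := univ) univ_mem
    (Eventually.of_forall fun y => (hint y).aestronglyMeasurable) (hint x)
    (T.integrable_comp (hint' x)).aestronglyMeasurable
    (Eventually.of_forall fun a y _ => ?_)
    ((hκ.norm.const_mul M).const_mul _) (Eventually.of_forall fun a y _ => ?_)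
  · refine (T.le_opNorm _).trans ?_
    rw [norm_smul, mul_comm ‖κ a‖]
    gcongr
    exact hM' _
  · have h3 := (hd (y - r a)).comp y ((hasFDerivAt_id y).sub_const (r a))
    rw [ContinuousLinearMap.comp_id] at h3
    rw [map_smul]
    exact h3.const_smul (κ a)

theorem continuous_integral_translate {P : Type*} [NormedAddCommGroup P] [NormedSpace ℝ P]
    {h : E → P} (hcont : Continuous h) {M : ℝ} (hM : ∀ x, ‖h x‖ ≤ M) {κ : α → ℝ}
    (hκ : Integrable κ μ) {r : α → E} (hr : Measurable r) :
    Continuous fun x => ∫ a, κ a • h (x - r a) ∂μ := by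
  refine continuous_of_dominated (bound := fun a => M * ‖κ a‖)
    (fun y => (integrable_smul_translate hcont hM hκ hr y).aestronglyMeasurable)
    (fun y => Eventually.of_forall fun a => ?_)
    (hκ.norm.const_mul M) (Eventually.of_forall fun a => ?_)
  · rw [norm_smul, mul_comm]
    gcongr
    exact hM _
  · exact (hcont.comp (continuous_id.sub continuous_const)).const_smul (κ a)

theorem integrable_smul_iteratedFDeriv_translate {k : ℕ} {f : E → ℝ} (hf : ContDiff ℝ k f)
    (hc : HasCompactSupport f) {κ : α → ℝ} (hκ : Integrable κ μ) {r : α → E} (hr : Measurable r)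
    {j : ℕ} (hj : j ≤ k) (x : E) :
    Integrable (fun a => κ a • iteratedFDeriv ℝ j f (x - r a)) μ := by
  obtain ⟨M, -, hM⟩ := exists_norm_iteratedFDeriv_le hf hc
  exact integrable_smul_translate (hf.continuous_iteratedFDeriv (by exact_mod_cast hj)) (hM j hj)
    hκ hr x

/-- Differentiation of an average of translates under the integral. -/
theorem hasFTaylorSeriesUpTo_integral_translate {k : ℕ} {f : E → ℝ} (hf : ContDiff ℝ k f)
    (hc : HasCompactSupport f) {κ : α → ℝ} (hκ : Integrable κ μ) {r : α → E} (hr : Measurable r) :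
    HasFTaylorSeriesUpTo k (fun x => ∫ a, κ a • f (x - r a) ∂μ)
      (fun x j => ∫ a, κ a • iteratedFDeriv ℝ j f (x - r a) ∂μ) := by
  obtain ⟨M, -, hM⟩ := exists_norm_iteratedFDeriv_le hf hc
  have hint := fun j (hj : j ≤ k) x =>
    integrable_smul_iteratedFDeriv_translate hf hc hκ hr hj x
  have hcont : ∀ j : ℕ, j ≤ k → Continuous (iteratedFDeriv ℝ j f) := fun j hj =>
    hf.continuous_iteratedFDeriv (by exact_mod_cast hj)
  have key : ∀ m : ℕ, m + 1 ≤ k → ∀ x,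
      HasFDerivAt (fun x => ∫ a, κ a • iteratedFDeriv ℝ m f (x - r a) ∂μ)
        (curryLeftCLM E m (∫ a, κ a • iteratedFDeriv ℝ (m + 1) f (x - r a) ∂μ)) x := by
    intro m hm x
    have hd : ∀ y, HasFDerivAt (iteratedFDeriv ℝ m f)
        (curryLeftCLM E m (iteratedFDeriv ℝ (m + 1) f y)) y :=
      fun y => hf.ftaylorSeries.fderiv m (by exact_mod_cast hm) y
    exact hasFDerivAt_integral_translate (curryLeftCLM E m) hd (hcont m (by omega))
      (hcont (m + 1) hm) (hM m (by omega)) (hM (m + 1) hm) hκ hr x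
  constructor
  · intro x
    have h0 := ((continuousMultilinearCurryFin0 ℝ E
      ℝ).toContinuousLinearEquiv.toContinuousLinearMap.integral_comp_comm (hint 0 (by omega) x))
    refine Eq.trans h0.symm (integral_congr_ae (Eventually.of_forall fun a => ?_))
    simp
  · intro m hm x
    have hm' : m < k := by exact_mod_cast hm
    exact key m hm' x
  · intro m hm
    have hm' : m ≤ k := by exact_mod_cast hm
    exact continuous_integral_translate (hcont m hm') (hM m hm') hκ hr

theorem contDiff_integral_translate {k : ℕ} {f : E → ℝ} (hf : ContDiff ℝ k f)
    (hc : HasCompactSupport f) {κ : α → ℝ} (hκ : Integrable κ μ) {r : α → E} (hr : Measurable r) :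
    ContDiff ℝ k (fun x => ∫ a, κ a • f (x - r a) ∂μ) :=
  (hasFTaylorSeriesUpTo_integral_translate hf hc hκ hr).contDiff

/-- Comparison of two averages of translates. -/
theorem norm_iteratedFDeriv_integral_translate_sub_le {k : ℕ} {f : E → ℝ} (hf : ContDiff ℝ k f)
    (hc : HasCompactSupport f) {κ : α → ℝ} (hκ : Integrable κ μ) {r r' : α → E}
    (hr : Measurable r) (hr' : Measurable r') {j : ℕ} (hj : j ≤ k) (x : E) :
    ‖iteratedFDeriv ℝ j ((fun x => ∫ a, κ a • f (x - r a) ∂μ) -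
        fun x => ∫ a, κ a • f (x - r' a) ∂μ) x‖ ≤
      ∫ a, ‖κ a‖ * ‖iteratedFDeriv ℝ j f (x - r a) - iteratedFDeriv ℝ j f (x - r' a)‖ ∂μ := by
  have hjk : (j : WithTop ℕ∞) ≤ k := by exact_mod_cast hj
  rw [iteratedFDeriv_sub_apply
    ((contDiff_integral_translate hf hc hκ hr).of_le hjk).contDiffAt
    ((contDiff_integral_translate hf hc hκ hr').of_le hjk).contDiffAt,
    ← (hasFTaylorSeriesUpTo_integral_translate hf hc hκ hr).eq_iteratedFDeriv hjk x,
    ← (hasFTaylorSeriesUpTo_integral_translate hf hc hκ hr').eq_iteratedFDeriv hjk x,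
    ← integral_sub (integrable_smul_iteratedFDeriv_translate hf hc hκ hr hj x)
      (integrable_smul_iteratedFDeriv_translate hf hc hκ hr' hj x)]
  refine (norm_integral_le_integral_norm _).trans_eq (integral_congr_ae (Eventually.of_forall ?_))
  intro a
  simp only [← smul_sub, norm_smul]

end Averages

/-! ### Taylor polynomials in one variable -/

section Taylor

/-- A function whose derivatives of order less than `n` vanish at `0` is `O(s ^ n)`. -/
theorem abs_le_mul_abs_pow_of_iteratedDeriv_zero (n : ℕ) : ∀ {h : ℝ → ℝ}, ContDiff ℝ n h →
    (∀ i < n, iteratedDeriv i h 0 = 0) → ∀ {M S : ℝ},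
    (∀ s, |s| ≤ S → |iteratedDeriv n h s| ≤ M) → ∀ s, |s| ≤ S → |h s| ≤ M * |s| ^ n := by
  induction n with
  | zero => intro h _ _ M S hM s hs; simpa using hM s hs
  | succ n ih =>
    intro h hh h0 M S hM s hs
    have hd : ContDiff ℝ n (deriv h) := hh.deriv'
    have hb := ih hd (fun i hi => by rw [← iteratedDeriv_succ']; exact h0 (i + 1) (by omega))
      (M := M) (S := S) (fun s hs => by rw [← iteratedDeriv_succ']; exact hM s hs)
    have hM0 : 0 ≤ M := (abs_nonneg _).trans (hM 0 (by simpa using (abs_nonneg s).trans hs))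
    have hdiff : Differentiable ℝ h := hh.differentiable (by simp)
    -- The mean value inequality on an interval containing `0` and `s` raises the order of vanishing
    -- by one; the factorials lost compared with Taylor's formula are not needed.
    have h1 := (convex_Icc (-|s|) |s|).norm_image_sub_le_of_norm_deriv_le (f := h)
      (C := M * |s| ^ n) (x := 0) (y := s) (fun x _ => hdiff x)
      (fun x hx => by
        have hx' : |x| ≤ |s| := abs_le.2 hx
        refine (hb x (hx'.trans hs)).trans ?_
        gcongr) (by simp) (abs_le.1 le_rfl)
    have h2 : h 0 = 0 := by simpa using h0 0 (by omega)
    rw [h2] at h1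
    simpa [pow_succ, mul_assoc] using h1

theorem contDiff_polynomial_eval {n : WithTop ℕ∞} (P : Polynomial ℝ) :
    ContDiff ℝ n fun s => P.eval s := by
  simpa using P.contDiff_aeval (R := ℝ) (𝕜 := ℝ) n

theorem iteratedDeriv_polynomial_eval (P : Polynomial ℝ) (j : ℕ) :
    iteratedDeriv j (fun s => P.eval s) = fun s => (Polynomial.derivative^[j] P).eval s := by
  induction j with
  | zero => simp
  | succ j ih =>
    rw [iteratedDeriv_succ, ih, Function.iterate_succ_apply']
    ext s
    exact Polynomial.deriv _

/-- The Taylor polynomial of degree less than `m` at `b`. -/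
noncomputable def taylorPoly (g : ℝ → ℝ) (b : ℝ) (m : ℕ) : Polynomial ℝ :=
  ∑ i ∈ Finset.range m, Polynomial.C (iteratedDeriv i g b / i.factorial) * Polynomial.X ^ i

theorem taylorPoly_coeff (g : ℝ → ℝ) (b : ℝ) (m i : ℕ) :
    (taylorPoly g b m).coeff i = if i < m then iteratedDeriv i g b / i.factorial else 0 := by
  simp [taylorPoly, Polynomial.finsetSum_coeff, Polynomial.coeff_X_pow]

theorem degree_taylorPoly_lt (g : ℝ → ℝ) (b : ℝ) (m : ℕ) : (taylorPoly g b m).degree < m := by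
  rw [Polynomial.degree_lt_iff_coeff_zero]
  intro i hi
  rw [taylorPoly_coeff, if_neg (by omega)]

theorem iteratedDeriv_taylorPoly_zero (g : ℝ → ℝ) (b : ℝ) {m i : ℕ} (hi : i < m) :
    iteratedDeriv i (fun s => (taylorPoly g b m).eval s) 0 = iteratedDeriv i g b := by
  rw [iteratedDeriv_polynomial_eval]
  simp only [← Polynomial.coeff_zero_eq_eval_zero, Polynomial.coeff_iterate_derivative,
    taylorPoly_coeff, zero_add, if_pos hi, Nat.descFactorial_self, nsmul_eq_mul]
  field_simp

/-- `taylorPoly` is a polynomial in the increment `s`, hence the shift by `b` in `g` only. -/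
theorem contDiff_taylorRemainder {g : ℝ → ℝ} {n : WithTop ℕ∞} (hg : ContDiff ℝ n g) (b : ℝ)
    (m : ℕ) : ContDiff ℝ n fun s => g (s + b) - (taylorPoly g b m).eval s :=
  (hg.comp (contDiff_id.add contDiff_const)).sub (contDiff_polynomial_eval _)

theorem iteratedDeriv_taylorRemainder {g : ℝ → ℝ} (i : ℕ) (hg : ContDiff ℝ i g) (b : ℝ) (m : ℕ)
    (s : ℝ) : iteratedDeriv i (fun s => g (s + b) - (taylorPoly g b m).eval s) s =
      iteratedDeriv i g (s + b) - iteratedDeriv i (fun s => (taylorPoly g b m).eval s) s := by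
  have h1 : ContDiff ℝ i fun s => g (s + b) := hg.comp (contDiff_id.add contDiff_const)
  rw [iteratedDeriv_fun_sub h1.contDiffAt (contDiff_polynomial_eval _).contDiffAt,
    iteratedDeriv_comp_add_const]

theorem iteratedDeriv_taylorRemainder_zero {g : ℝ → ℝ} {i m : ℕ} (hg : ContDiff ℝ i g) (b : ℝ)
    (hi : i < m) : iteratedDeriv i (fun s => g (s + b) - (taylorPoly g b m).eval s) 0 = 0 := by
  rw [iteratedDeriv_taylorRemainder i hg, iteratedDeriv_taylorPoly_zero g b hi, zero_add, sub_self]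

/-- A function whose `m`-th derivative vanishes is a polynomial of degree less than `m`. -/
theorem eq_taylorPoly_of_iteratedDeriv_eq_zero {g : ℝ → ℝ} {m : ℕ} (hg : ContDiff ℝ m g)
    (h : ∀ s, iteratedDeriv m g s = 0) (s : ℝ) : g s = (taylorPoly g 0 m).eval s := by
  have := abs_le_mul_abs_pow_of_iteratedDeriv_zero m (contDiff_taylorRemainder hg 0 m)
    (fun i hi => iteratedDeriv_taylorRemainder_zero (hg.of_le (by exact_mod_cast hi.le)) 0 hi)
    (M := 0) (S := |s|) (fun t _ => by
      rw [iteratedDeriv_taylorRemainder m hg, h, iteratedDeriv_polynomial_eval,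
        Polynomial.iterate_derivative_eq_zero_of_degree_lt (degree_taylorPoly_lt g 0 m)]
      simp) s le_rfl
  rw [zero_mul, abs_nonpos_iff, add_zero, sub_eq_zero] at this
  exact this

/-- The derivatives of `t ↦ r (w t)` are `O(w ^ n)` if the Taylor polynomial of `r` of degree less
than `n` vanishes. -/
theorem exists_abs_iteratedDeriv_comp_mul_le {r : ℝ → ℝ} (hr : ContDiff ℝ (⊤ : ℕ∞) r) {n : ℕ}
    (h0 : ∀ i < n, iteratedDeriv i r 0 = 0) (k : ℕ) {ρ : ℝ} (hρ : 1 ≤ ρ) :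
    ∃ M : ℝ, 0 ≤ M ∧ ∀ w : ℝ, |w| * ρ ≤ 1 → ∀ j ≤ k, ∀ t, |t| ≤ ρ →
      |iteratedDeriv j (fun t => r (w * t)) t| ≤ M * |w| ^ n := by
  have hsm : ∀ i : ℕ, ContDiff ℝ i r := fun i => hr.of_le (by exact_mod_cast le_top)
  have hsm' : ∀ i j : ℕ, ContDiff ℝ i (iteratedDeriv j r) := fun i j => by
    have h1 : ContDiff ℝ ((i + j : ℕ) : WithTop ℕ∞) r := hsm (i + j)
    rw [iteratedDeriv_eq_iterate]
    exact ContDiff.iterate_deriv' i j h1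
  have hb : ∀ j, ∃ C : ℝ, ∀ s, |s| ≤ 1 → |iteratedDeriv (n - j) (iteratedDeriv j r) s| ≤ C := by
    intro j
    obtain ⟨C, hC⟩ := (isCompact_Icc (a := (-1 : ℝ)) (b := 1)).exists_bound_of_continuousOn
      (((hsm' (n - j) j).continuous_iteratedDeriv (n - j) le_rfl).continuousOn)
    exact ⟨C, fun s hs => hC s (abs_le.1 hs)⟩
  choose C hC using hb
  set M := ∑ j ∈ Finset.range (k + 1), |C j| with hMdef
  refine ⟨M * ρ ^ n, by positivity, fun w hw j hj t ht => ?_⟩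
  have hw1 : |w| ≤ 1 := by
    have := mul_le_mul_of_nonneg_left hρ (abs_nonneg w)
    linarith
  have hwt : |w * t| ≤ 1 := by
    rw [abs_mul]
    exact (mul_le_mul_of_nonneg_left ht (abs_nonneg w)).trans hw
  have hCM : C j ≤ M := (le_abs_self _).trans (Finset.single_le_sum (f := fun j => |C j|)
      (fun _ _ => abs_nonneg _) (Finset.mem_range.2 (by omega)))
  -- The `j`-th derivative of `r` vanishes at `0` to order `n - j`, and the chain rule supplies the
  -- other `j` powers of `w`. For `j > n` the subtraction truncates to `0`, and `|w| ≤ 1` gives the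
  -- bound.
  have h1 := abs_le_mul_abs_pow_of_iteratedDeriv_zero (n - j) (hsm' (n - j) j)
    (fun i hi => by
      have : iteratedDeriv i (iteratedDeriv j r) = iteratedDeriv (i + j) r := by
        simp only [iteratedDeriv_eq_iterate, Function.iterate_add_apply]
      rw [this]
      exact h0 _ (by omega)) (M := M) (S := 1)
    (fun s hs => (hC j s hs).trans hCM) (w * t) hwt
  have h2 : iteratedDeriv j (fun t => r (w * t)) t = w ^ j * iteratedDeriv j r (w * t) := by
    rw [iteratedDeriv_comp_const_mul (hsm j)]
  have hM0 : 0 ≤ M := by positivity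
  rw [h2, abs_mul, abs_pow]
  calc |w| ^ j * |iteratedDeriv j r (w * t)| ≤ |w| ^ j * (M * |w * t| ^ (n - j)) := by gcongr
    _ ≤ |w| ^ j * (M * (|w| * ρ) ^ (n - j)) := by rw [abs_mul]; gcongr
    _ = M * |w| ^ (j + (n - j)) * ρ ^ (n - j) := by rw [mul_pow, pow_add]; ring
    _ ≤ M * |w| ^ n * ρ ^ n := by
        gcongr M * ?_ * ?_
        · exact pow_le_pow_of_le_one (abs_nonneg _) hw1 (by omega)
        · exact pow_le_pow_right₀ hρ (by omega)
    _ = M * ρ ^ n * |w| ^ n := by ring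

end Taylor

/-! ### Monomials and the exponential function from dilates of one function. -/

section OneDimensional

variable {k : ℕ} {G : Submodule ℝ (ℝ → ℝ)}

/-- If all dilations and translations of a smooth `g` belong to a `C^k` closed subspace, then so
do the monomials, unless a derivative of `g` vanishes identically. -/
theorem iteratedDeriv_smul_pow_mem_ckClosure {g : ℝ → ℝ} (hg : ContDiff ℝ (⊤ : ℕ∞) g)
    (h : ∀ w b : ℝ, (fun t => g (w * t + b)) ∈ ckClosure k G) (b : ℝ) (m : ℕ) :
    (iteratedDeriv m g b • fun t : ℝ => t ^ m) ∈ ckClosure k G := by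
  induction m using Nat.strong_induction_on with
  | _ m ih =>
  have hm0 : (m.factorial : ℝ) ≠ 0 := by exact_mod_cast m.factorial_ne_zero
  refine mem_ckClosure_of_approx (contDiff_const.smul (contDiff_id.pow m)) fun ρ₀ ε _ hε => ?_
  set ρ := max ρ₀ 1
  have hρ : 1 ≤ ρ := le_max_right _ _
  set r : ℝ → ℝ := fun s => g (s + b) - (taylorPoly g b (m + 1)).eval s with hr
  have hrs : ContDiff ℝ (⊤ : ℕ∞) r := contDiff_taylorRemainder hg b (m + 1)
  obtain ⟨M, hM0, hM⟩ := exists_abs_iteratedDeriv_comp_mul_le hrs (n := m + 1)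
    (fun i hi => iteratedDeriv_taylorRemainder_zero (hg.of_le (by exact_mod_cast le_top)) b hi)
    k hρ
  obtain ⟨w, hw0, hwρ, hwε⟩ : ∃ w : ℝ, 0 < w ∧ w * ρ ≤ 1 ∧ m.factorial * M * w ≤ ε := by
    refine ⟨min (1 / ρ) (ε / (m.factorial * M + 1)), by positivity, ?_, ?_⟩
    · calc _ ≤ 1 / ρ * ρ := by gcongr; exact min_le_left _ _
        _ = 1 := by field_simp
    · calc _ ≤ (m.factorial * M + 1) * (ε / (m.factorial * M + 1)) := by
            gcongr
            · linarith
            · exact min_le_right _ _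
        _ = ε := by field_simp
  have hsum : ∀ t : ℝ, (taylorPoly g b (m + 1)).eval (w * t) =
      (∑ i ∈ Finset.range m, iteratedDeriv i g b / i.factorial * w ^ i * t ^ i) +
        iteratedDeriv m g b / m.factorial * w ^ m * t ^ m := by
    intro t
    simp only [taylorPoly, Polynomial.eval_finsetSum, Finset.sum_range_succ, Polynomial.eval_add,
      Polynomial.eval_mul, Polynomial.eval_C, Polynomial.eval_pow, Polynomial.eval_X, mul_pow]
    simp only [mul_assoc]
  -- The Taylor terms below order `m` lie in the closure by induction. Subtracting them from the
  -- dilate of `g` and dividing by `w ^ m / m!` isolates the term of order `m`, up to an error of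
  -- size `m! * M * w`.
  refine ⟨(m.factorial / w ^ m) • ((fun t => g (w * t + b)) -
    ∑ i ∈ Finset.range m, (w ^ i / i.factorial) • (iteratedDeriv i g b • fun t : ℝ => t ^ i)),
    ?_, ?_⟩
  · refine Submodule.smul_mem _ _ (Submodule.sub_mem _ (h w b) (Submodule.sum_mem _ fun i hi => ?_))
    exact Submodule.smul_mem _ _ (ih i (Finset.mem_range.1 hi))
  · intro j hj t ht
    have he : ((iteratedDeriv m g b • fun t : ℝ => t ^ m) -
        (m.factorial / w ^ m) • ((fun t => g (w * t + b)) -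
          ∑ i ∈ Finset.range m, (w ^ i / i.factorial) • (iteratedDeriv i g b • fun t : ℝ => t ^ i)))
        = (-(m.factorial / w ^ m) : ℝ) • fun t => r (w * t) := by
      ext t
      simp only [Pi.sub_apply, Pi.smul_apply, Finset.sum_apply, smul_eq_mul, hr, hsum]
      have : ∑ i ∈ Finset.range m, w ^ i / i.factorial * (iteratedDeriv i g b * t ^ i) =
          ∑ i ∈ Finset.range m, iteratedDeriv i g b / i.factorial * w ^ i * t ^ i :=
        Finset.sum_congr rfl fun i _ => by ring
      rw [this]
      field_simp
      ring
    have ht' : |t| ≤ ρ := by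
      have : |t| < ρ₀ := by simpa using ht
      exact this.le.trans (le_max_left _ _)
    rw [he, norm_iteratedFDeriv_eq_norm_iteratedDeriv, iteratedDeriv_const_smul_field,
      norm_smul, norm_neg, Real.norm_eq_abs, Real.norm_eq_abs, abs_of_pos (by positivity)]
    calc _ ≤ m.factorial / w ^ m * (M * |w| ^ (m + 1)) := by
          gcongr
          exact hM w (by rwa [abs_of_pos hw0]) j hj t ht'
      _ = m.factorial * M * w := by
          rw [abs_of_pos hw0, pow_succ]
          field_simp
      _ ≤ ε := hwε

/-- If all monomials belong to a `C^k` closed subspace, then so does the exponential function. -/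
theorem exp_mem_ckClosure (h : ∀ m : ℕ, (fun t : ℝ => t ^ m) ∈ ckClosure k G) :
    Real.exp ∈ ckClosure k G := by
  let p : ℕ → ℝ → ℝ := fun n t => ∑ m ∈ Finset.range n, t ^ m / m.factorial
  have hpc : ∀ n (j : ℕ), ContDiff ℝ j (p n) := fun n j =>
    ContDiff.sum fun m _ => (contDiff_id.pow m).div_const _
  have hpd : ∀ n, deriv (p (n + 1)) = p n := by
    intro n
    ext t
    have h1 : HasDerivAt (p (n + 1))
        (∑ m ∈ Finset.range (n + 1), m * t ^ (m - 1) / m.factorial) t :=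
      HasDerivAt.fun_sum fun m _ => (hasDerivAt_pow m t).div_const _
    rw [h1.deriv, Finset.sum_range_succ']
    simp only [Nat.cast_zero, zero_mul, zero_div, add_zero, p]
    refine Finset.sum_congr rfl fun m _ => ?_
    rw [Nat.factorial_succ, Nat.add_sub_cancel]
    push_cast
    field_simp
  -- Differentiating an error of the exponential series gives an earlier error of the same series,
  -- so uniform convergence of the values controls all derivatives. Starting from `p (N + k)`, at
  -- most `k` derivatives leave an index at least `N`.
  have hdj : ∀ j n, iteratedDeriv j (fun t => Real.exp t - p (n + j) t) =
      fun t => Real.exp t - p n t := by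
    intro j
    induction j with
    | zero => intro n; simp
    | succ j ih =>
      intro n
      rw [iteratedDeriv_succ', ← ih n]
      congr 1
      ext t
      have h1 : HasDerivAt (fun t => Real.exp t - p (n + (j + 1)) t)
          (Real.exp t - deriv (p (n + (j + 1))) t) t :=
        (Real.hasDerivAt_exp t).sub
          (((hpc _ 1).differentiable (by simp)) t).hasDerivAt
      rw [h1.deriv, ← add_assoc, hpd]
  refine mem_ckClosure_of_approx Real.contDiff_exp fun ρ ε hρ hε => ?_
  have hu : TendstoUniformlyOn p Real.exp atTop (Icc (-ρ) ρ) := by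
    have := tendstoUniformlyOn_tsum_nat (f := fun (m : ℕ) (t : ℝ) => t ^ m / m.factorial)
      (Real.summable_pow_div_factorial ρ) (s := Icc (-ρ) ρ) (fun n x hx => by
        rw [norm_div, norm_pow, Real.norm_eq_abs, Real.norm_natCast]
        gcongr
        exact abs_le.2 hx)
    refine this.congr_right fun t _ => ?_
    rw [Real.exp_eq_exp_ℝ, NormedSpace.exp_eq_tsum_div]
  obtain ⟨N, hN⟩ := eventually_atTop.1 (Metric.tendstoUniformlyOn_iff.1 hu ε hε)
  refine ⟨p (N + k), ?_, fun j hj t ht => ?_⟩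
  · have : p (N + k) = ∑ m ∈ Finset.range (N + k), ((m.factorial : ℝ)⁻¹) • fun t : ℝ => t ^ m := by
      ext t
      simp only [p, Finset.sum_apply, Pi.smul_apply, smul_eq_mul]
      exact Finset.sum_congr rfl fun m _ => by ring
    rw [this]
    exact Submodule.sum_mem _ fun m _ => Submodule.smul_mem _ _ (h m)
  · rw [norm_iteratedFDeriv_eq_norm_iteratedDeriv]
    have h1 := hdj j (N + (k - j))
    rw [show N + (k - j) + j = N + k by omega] at h1
    rw [show Real.exp - p (N + k) = fun t => Real.exp t - p (N + k) t from rfl, h1]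
    have h2 := hN (N + (k - j)) (by omega) t (abs_le.1 (by
      have : |t| < ρ := by simpa using ht
      exact this.le))
    rw [Real.dist_eq] at h2
    exact h2.le

end OneDimensional

/-! ### Ridge functions -/

section Ridge

variable {E F : Type*} [NormedAddCommGroup E] [NormedSpace ℝ E]
  [NormedAddCommGroup F] [NormedSpace ℝ F]

/-- The span of the functions `x ↦ σ (p x + b)`. -/
def ridgeSpan (E : Type*) [NormedAddCommGroup E] [NormedSpace ℝ E] (σ : ℝ → ℝ) :
    Submodule ℝ (E → ℝ) :=
  Submodule.span ℝ (range fun (p : (E →L[ℝ] ℝ) × ℝ) (x : E) => σ (p.1 x + p.2))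

theorem ridge_mem_ridgeSpan (σ : ℝ → ℝ) (p : E →L[ℝ] ℝ) (b : ℝ) :
    (fun x => σ (p x + b)) ∈ ridgeSpan E σ :=
  Submodule.subset_span ⟨(p, b), rfl⟩

theorem comp_affine_mem_ridgeSpan {σ : ℝ → ℝ} (A : E →L[ℝ] F) (b : F) {g : F → ℝ}
    (hg : g ∈ ridgeSpan F σ) : (fun x => g (A x + b)) ∈ ridgeSpan E σ := by
  induction hg using Submodule.span_induction with
  | mem g hg =>
    obtain ⟨⟨p, c⟩, rfl⟩ := hg
    have := ridge_mem_ridgeSpan σ (p.comp A) (p b + c)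
    simpa only [map_add, add_assoc, ContinuousLinearMap.comp_apply] using this
  | zero => exact Submodule.zero_mem _
  | add f g _ _ hf hg => exact Submodule.add_mem _ hf hg
  | smul c f _ hf => exact Submodule.smul_mem _ c hf

theorem contDiff_of_mem_ridgeSpan {σ : ℝ → ℝ} {k : ℕ} (hσ : ContDiff ℝ k σ) {g : E → ℝ}
    (hg : g ∈ ridgeSpan E σ) : ContDiff ℝ k g := by
  induction hg using Submodule.span_induction with
  | mem g hg =>
    obtain ⟨⟨p, c⟩, rfl⟩ := hg
    exact hσ.comp (p.contDiff.add contDiff_const)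
  | zero => exact contDiff_const
  | add f g _ _ hf hg => exact ContDiff.add hf hg
  | smul c f _ hf => exact contDiff_const.smul hf

theorem comp_affine_mem_ckClosure_ridgeSpan {σ : ℝ → ℝ} {k : ℕ} (A : E →L[ℝ] F) (b : F) {g : F → ℝ}
    (hg : g ∈ ckClosure k (ridgeSpan F σ)) :
    (fun x => g (A x + b)) ∈ ckClosure k (ridgeSpan E σ) :=
  comp_affine_mem_ckClosure A b (fun _ h => comp_affine_mem_ridgeSpan A b h) hg

end Ridge

/-! ### Mollification of the activation function -/

section Mollify

/-- The mollification `∫ φ(s) σ(t - s) ds`. -/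
noncomputable def mollify (φ : ContDiffBump (0 : ℝ)) (σ : ℝ → ℝ) (t : ℝ) : ℝ :=
  ∫ s, φ.normed volume s • σ (t - s)

theorem contDiff_mollify (φ : ContDiffBump (0 : ℝ)) {σ : ℝ → ℝ} (hσ : Continuous σ) (n : ℕ∞) :
    ContDiff ℝ n (mollify φ σ) :=
  φ.hasCompactSupport_normed.contDiff_convolution_left (ContinuousLinearMap.lsmul ℝ ℝ)
    φ.contDiff_normed hσ.locallyIntegrable

/-- Rounding the shift `s` down to the grid of step `1 / m` turns the convolution into a finite
combination of translates of `σ`. Both are averages of translates with the same weight, so uniform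
continuity of the derivatives of `σ` compares them in all orders up to `k`. -/
theorem mollify_mem_ckClosure {k : ℕ} {σ : ℝ → ℝ} (hσ : ContDiff ℝ k σ) (φ : ContDiffBump (0 : ℝ))
    (hφ : φ.rOut ≤ 1) : mollify φ σ ∈ ckClosure k (ridgeSpan ℝ σ) := by
  have hcm : ContDiff ℝ k (mollify φ σ) := contDiff_mollify φ hσ.continuous k
  refine mem_ckClosure_of_approx hcm fun ρ ε hρ hε => ?_
  -- On the ball of radius `ρ`, shifts of length at most `1` only see `σ` on the ball of radius `ρ +
  -- 1`, where the compactly supported `τ` agrees with it.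
  obtain ⟨τ, hτ, hτc, hτe⟩ := exists_hasCompactSupport_eq hσ (ρ + 1)
  obtain ⟨δ, hδ, hδτ⟩ := exists_norm_iteratedFDeriv_sub_le hτ hτc hε
  obtain ⟨m, hm⟩ := exists_nat_gt (1 / δ)
  have hm0 : (0 : ℝ) < m := (by positivity : 0 < 1 / δ).trans hm
  have hmδ : 1 / (m : ℝ) ≤ δ := by
    rw [div_lt_iff₀ hδ] at hm
    rw [div_le_iff₀ hm0]
    linarith
  set κ : ℝ → ℝ := φ.normed volume with hκdef
  have hκ : Integrable κ := φ.integrable_normed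
  have hκs : ∀ s, κ s ≠ 0 → |s| < 1 := by
    intro s hs
    have : s ∈ Function.support κ := hs
    rw [hκdef, φ.support_normed_eq, mem_ball_zero_iff] at this
    exact this.trans_le hφ
  set r : ℝ → ℝ := fun s => (⌊m * s⌋ : ℝ) / m with hr
  have hrm : Measurable r :=
    ((measurable_from_top (f := fun i : ℤ => (i : ℝ))).comp
      (Int.measurable_floor.comp (measurable_const.mul measurable_id))).div_const _
  have hrs : ∀ s, |s - r s| ≤ δ := by
    intro s
    have h1 : s - r s = (m * s - ⌊m * s⌋) / m := by simp only [hr]; field_simp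
    rw [h1, abs_div, abs_of_pos hm0, abs_of_nonneg (Int.fract_nonneg _)]
    refine le_trans ?_ hmδ
    gcongr
    exact (Int.fract_lt_one _).le
  let S : ℤ → Set ℝ := fun i => {s | ⌊m * s⌋ = i}
  have hS : ∀ i, MeasurableSet (S i) := fun i =>
    (Int.measurable_floor.comp (measurable_const.mul measurable_id)) (measurableSet_singleton i)
  let g : ℝ → ℝ := ∑ i ∈ Finset.Icc (-m : ℤ) m,
    (∫ s, (S i).indicator κ s) • fun t : ℝ => σ (t - i / m)
  have hg : g ∈ ridgeSpan ℝ σ := by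
    refine Submodule.sum_mem _ fun i _ => Submodule.smul_mem _ _ ?_
    exact ridge_mem_ridgeSpan σ (ContinuousLinearMap.id ℝ ℝ) (-(i / m : ℝ))
  refine ⟨g, mem_ckClosure_of_mem hg (contDiff_of_mem_ridgeSpan hσ hg), fun j hj x hx => ?_⟩
  have e1 : ∀ t ∈ ball (0 : ℝ) ρ, mollify φ σ t = ∫ s, κ s • τ (t - s) := by
    intro t ht
    rw [mem_ball_zero_iff, Real.norm_eq_abs] at ht
    refine integral_congr_ae (Eventually.of_forall fun s => ?_)
    by_cases hs : κ s = 0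
    · simp only [← hκdef, hs, zero_smul]
    · have : τ (t - s) = σ (t - s) := hτe _ (by
        rw [mem_ball_zero_iff, Real.norm_eq_abs]
        linarith [abs_sub t s, hκs s hs])
      simp only [← hκdef, this]
  have e2 : ∀ t ∈ ball (0 : ℝ) ρ, g t = ∫ s, κ s • τ (t - r s) := by
    intro t ht
    rw [mem_ball_zero_iff, Real.norm_eq_abs] at ht
    have h1 : ∀ s, κ s • τ (t - r s) =
        ∑ i ∈ Finset.Icc (-m : ℤ) m, (S i).indicator κ s * σ (t - i / m) := by
      intro s
      by_cases hs : κ s = 0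
      · rw [hs, zero_smul]
        refine (Finset.sum_eq_zero fun i _ => ?_).symm
        rw [indicator_apply, hs, ite_self, zero_mul]
      · have hs1 := abs_lt.1 (hκs s hs)
        have hfl : ⌊m * s⌋ ∈ Finset.Icc (-m : ℤ) m := by
          rw [Finset.mem_Icc]
          constructor
          · rw [Int.le_floor]
            push_cast
            nlinarith
          · have : (⌊m * s⌋ : ℝ) ≤ (m : ℤ) := (Int.floor_le _).trans (by push_cast; nlinarith)
            exact_mod_cast this
        rw [Finset.sum_eq_single_of_mem _ hfl fun i _ hi => by
          rw [indicator_of_notMem (fun h => hi h.symm), zero_mul]]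
        rw [indicator_of_mem (show s ∈ S ⌊m * s⌋ from rfl), smul_eq_mul]
        congr 1
        refine hτe _ ?_
        rw [mem_ball_zero_iff, Real.norm_eq_abs]
        have h2 : |r s| ≤ 1 := by
          rw [hr]
          simp only
          rw [abs_div, abs_of_pos hm0, div_le_one hm0]
          rw [Finset.mem_Icc] at hfl
          rw [abs_le]
          exact ⟨by exact_mod_cast hfl.1, by exact_mod_cast hfl.2⟩
        linarith [abs_sub t (r s)]
    simp_rw [h1]
    rw [integral_finsetSum _ fun i _ => ((hκ.indicator (hS i)).mul_const _)]
    simp only [g, Finset.sum_apply, Pi.smul_apply, smul_eq_mul, integral_mul_const]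
  have e3 : (mollify φ σ - g) =ᶠ[𝓝 x] ((fun t => ∫ s, κ s • τ (t - s)) -
      fun t => ∫ s, κ s • τ (t - r s)) := by
    filter_upwards [isOpen_ball.mem_nhds hx] with t ht
    rw [Pi.sub_apply, Pi.sub_apply, e1 t ht, e2 t ht]
  rw [(e3.iteratedFDeriv ℝ j).eq_of_nhds]
  refine (norm_iteratedFDeriv_integral_translate_sub_le hτ hτc hκ measurable_id hrm hj x).trans ?_
  calc _ ≤ ∫ s, κ s * ε := by
        refine integral_mono_of_nonneg (Eventually.of_forall fun s => by positivity)
          (hκ.mul_const _) (Eventually.of_forall fun s => ?_)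
        simp only
        rw [Real.norm_of_nonneg (φ.nonneg_normed s)]
        refine mul_le_mul_of_nonneg_left (hδτ j hj _ _ ?_) (φ.nonneg_normed s)
        rw [id, sub_sub_sub_cancel_left, norm_sub_rev]
        exact hrs s
    _ = ε := by rw [integral_mul_const, hκdef, φ.integral_normed, one_mul]

/-- All monomials are limits of linear combinations of translated dilations of a function that is
not a polynomial. -/
theorem pow_mem_ckClosure {k : ℕ} {σ : ℝ → ℝ} (hσ : ContDiff ℝ k σ)
    (hσp : ¬ ∃ P : Polynomial ℝ, ∀ t : ℝ, σ t = P.eval t) (m : ℕ) :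
    (fun t : ℝ => t ^ m) ∈ ckClosure k (ridgeSpan ℝ σ) := by
  by_contra hcon
  -- One nonzero value of an `m`-th derivative would already put `t ^ m` in the closure. So all
  -- mollifications are polynomials of degree less than `m`.
  have hzero : ∀ φ : ContDiffBump (0 : ℝ), φ.rOut ≤ 1 →
      ∀ b, iteratedDeriv m (mollify φ σ) b = 0 := by
    intro φ hφ b
    by_contra hne
    have h1 := iteratedDeriv_smul_pow_mem_ckClosure (G := ridgeSpan ℝ σ) (k := k)
      (contDiff_mollify φ hσ.continuous _)
      (fun w b => comp_affine_mem_ckClosure_ridgeSpan (w • ContinuousLinearMap.id ℝ ℝ) b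
        (mollify_mem_ckClosure hσ φ hφ)) b m
    refine hcon ?_
    have h2 := Submodule.smul_mem _ (iteratedDeriv m (mollify φ σ) b)⁻¹ h1
    rwa [smul_smul, inv_mul_cancel₀ hne, one_smul] at h2
  have hinj : Set.InjOn (fun i : ℕ => (i : ℝ)) (Finset.range m) :=
    fun i _ j _ h => Nat.cast_injective (R := ℝ) h
  -- Polynomials of degree less than `m` are determined by their values at `0, …, m - 1`. This form
  -- survives the pointwise limit of the mollifications, which makes `σ` itself a polynomial.
  have hpoly : ∀ φ : ContDiffBump (0 : ℝ), φ.rOut ≤ 1 → ∀ t, mollify φ σ t =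
      ∑ i ∈ Finset.range m, mollify φ σ i *
        (Lagrange.basis (Finset.range m) (fun i : ℕ => (i : ℝ)) i).eval t := by
    intro φ hφ t
    have h1 := eq_taylorPoly_of_iteratedDeriv_eq_zero (m := m)
      (contDiff_mollify φ hσ.continuous m) (hzero φ hφ)
    have h2 := Lagrange.eq_interpolate (f := taylorPoly (mollify φ σ) 0 m) hinj
      (by rw [Finset.card_range]; exact degree_taylorPoly_lt _ _ _)
    rw [h1 t, h2, Lagrange.interpolate_apply, Polynomial.eval_finsetSum]
    refine Finset.sum_congr rfl fun i _ => ?_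
    rw [Polynomial.eval_mul, Polynomial.eval_C, ← h1]
  let φ : ℕ → ContDiffBump (0 : ℝ) := fun n =>
    ⟨1 / ((n : ℝ) + 1) / 2, 1 / ((n : ℝ) + 1), by positivity, half_lt_self (by positivity)⟩
  have hφ1 : ∀ n, (φ n).rOut ≤ 1 := fun n => by
    change 1 / ((n : ℝ) + 1) ≤ 1
    rw [div_le_one (by positivity)]
    linarith [Nat.cast_nonneg (α := ℝ) n]
  have hlim : ∀ t, Tendsto (fun n => mollify (φ n) σ t) atTop (𝓝 (σ t)) := fun t =>
    ContDiffBump.convolution_tendsto_right_of_continuous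
      tendsto_one_div_add_atTop_nhds_zero_nat hσ.continuous t
  refine hσp ⟨Lagrange.interpolate (Finset.range m) (fun i : ℕ => (i : ℝ)) fun i => σ i,
    fun t => ?_⟩
  refine tendsto_nhds_unique (hlim t) ?_
  rw [Lagrange.interpolate_apply, Polynomial.eval_finsetSum]
  simp_rw [fun n => hpoly (φ n) (hφ1 n) t, Polynomial.eval_mul, Polynomial.eval_C]
  exact tendsto_finsetSum _ fun i _ => (hlim i).mul_const _

end Mollify

/-! ### Density of linear combinations of exponentials -/

section Exponentials

variable {E : Type*} [NormedAddCommGroup E] [NormedSpace ℝ E]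

/-- The span of the functions `x ↦ exp (p x)`, `p` linear. -/
def expSpan (E : Type*) [NormedAddCommGroup E] [NormedSpace ℝ E] : Submodule ℝ (E → ℝ) :=
  Submodule.span ℝ (range fun (p : E →L[ℝ] ℝ) (x : E) => Real.exp (p x))

theorem exp_mem_expSpan (p : E →L[ℝ] ℝ) : (fun x => Real.exp (p x)) ∈ expSpan E :=
  Submodule.subset_span ⟨p, rfl⟩

theorem one_mem_expSpan : (1 : E → ℝ) ∈ expSpan E := by
  have h : (fun x : E => Real.exp ((0 : E →L[ℝ] ℝ) x)) = 1 := by ext; simp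
  exact h ▸ exp_mem_expSpan (0 : E →L[ℝ] ℝ)

theorem mul_mem_expSpan {f g : E → ℝ} (hf : f ∈ expSpan E) (hg : g ∈ expSpan E) :
    f * g ∈ expSpan E := by
  have h := Submodule.mul_mem_mul hf hg
  rw [expSpan, Submodule.span_mul_span] at h
  refine Submodule.span_mono ?_ h
  rintro _ ⟨_, ⟨p, rfl⟩, _, ⟨q, rfl⟩, rfl⟩
  refine ⟨p + q, ?_⟩
  ext x
  simp [Real.exp_add]

theorem pow_mem_expSpan {f : E → ℝ} (hf : f ∈ expSpan E) (n : ℕ) : f ^ n ∈ expSpan E := by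
  induction n with
  | zero => simpa using one_mem_expSpan
  | succ n ih => rw [pow_succ]; exact mul_mem_expSpan ih hf

theorem contDiff_of_mem_expSpan {n : WithTop ℕ∞} {g : E → ℝ} (hg : g ∈ expSpan E) :
    ContDiff ℝ n g := by
  induction hg using Submodule.span_induction with
  | mem g hg =>
    obtain ⟨p, rfl⟩ := hg
    exact Real.contDiff_exp.comp p.contDiff
  | zero => exact contDiff_const
  | add f g _ _ hf hg => exact ContDiff.add hf hg
  | smul c f _ hf => exact contDiff_const.smul hf

/-- Convolution with an exponential polynomial gives an exponential polynomial. -/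
theorem integral_mul_mem_expSpan [MeasurableSpace E] [BorelSpace E] [FiniteDimensional ℝ E]
    {μ : Measure E} [IsFiniteMeasureOnCompacts μ] {f : E → ℝ} (hf : Continuous f)
    (hc : HasCompactSupport f) {q : E → ℝ} (hq : q ∈ expSpan E) :
    (fun x => ∫ y, q (x - y) * f y ∂μ) ∈ expSpan E := by
  have hint : ∀ {g : E → ℝ}, g ∈ expSpan E → ∀ x, Integrable (fun y => g (x - y) * f y) μ :=
    fun hg x => (((contDiff_of_mem_expSpan (n := 0) hg).continuous.comp
      (continuous_const.sub continuous_id)).mul hf).integrable_of_hasCompactSupport hc.mul_left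
  induction hq using Submodule.span_induction with
  | mem g hg =>
    obtain ⟨p, rfl⟩ := hg
    have h := Submodule.smul_mem _ (∫ y, Real.exp (-p y) * f y ∂μ) (exp_mem_expSpan p)
    convert h using 1
    ext x
    simp only [Pi.smul_apply, smul_eq_mul, ← integral_mul_const]
    congr 1
    ext y
    rw [map_sub, sub_eq_add_neg, Real.exp_add]
    ring
  | zero =>
    simp only [Pi.zero_apply, zero_mul, integral_zero]
    exact Submodule.zero_mem _
  | add g₁ g₂ h₁ h₂ hg₁ hg₂ =>
    have h := Submodule.add_mem _ hg₁ hg₂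
    convert h using 1
    ext x
    simp only [Pi.add_apply, add_mul]
    exact integral_add (hint h₁ x) (hint h₂ x)
  | smul c g _ hg =>
    have h := Submodule.smul_mem _ c hg
    convert h using 1
    ext x
    simp only [Pi.smul_apply, smul_eq_mul, mul_assoc, integral_const_mul]

/-- An exponential polynomial with a unique maximum on a given ball. -/
theorem exists_mem_expSpan_peak (d : ℕ) (r : ℝ) :
    ∃ h ∈ expSpan (EuclideanSpace ℝ (Fin d)), h 0 = 1 ∧
      ∀ s ∈ closedBall (0 : EuclideanSpace ℝ (Fin d)) r, 0 ≤ h s ∧ (s ≠ 0 → h s < 1) := by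
  -- A nonnegative exponential polynomial vanishing only at the origin; the peak function is `1`
  -- minus a small multiple of it.
  let c : EuclideanSpace ℝ (Fin d) → ℝ := fun s => ∑ i, (Real.cosh (s i) - 1)
  have hc : c ∈ expSpan (EuclideanSpace ℝ (Fin d)) := by
    have : c = ∑ i, ((2⁻¹ : ℝ) • ((fun s => Real.exp (EuclideanSpace.proj (𝕜 := ℝ) i s)) +
        fun s => Real.exp ((-EuclideanSpace.proj (𝕜 := ℝ) i : _ →L[ℝ] ℝ) s)) - 1) := by
      ext s
      simp only [c, Finset.sum_apply, Pi.sub_apply, Pi.smul_apply, Pi.add_apply, Pi.one_apply,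
        smul_eq_mul, Real.cosh_eq]
      refine Finset.sum_congr rfl fun i _ => ?_
      simp
      ring
    rw [this]
    exact Submodule.sum_mem _ fun i _ => Submodule.sub_mem _ (Submodule.smul_mem _ _
      (Submodule.add_mem _ (exp_mem_expSpan _) (exp_mem_expSpan _))) one_mem_expSpan
  obtain ⟨B, hB⟩ := (isCompact_closedBall (0 : EuclideanSpace ℝ (Fin d))
    r).exists_bound_of_continuousOn (contDiff_of_mem_expSpan (n := 0) hc).continuous.continuousOn
  have hc0 : ∀ s, 0 ≤ c s := fun s =>
    Finset.sum_nonneg fun i _ => sub_nonneg.2 (Real.one_le_cosh _)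
  refine ⟨1 - (|B| + 1)⁻¹ • c, Submodule.sub_mem _ one_mem_expSpan (Submodule.smul_mem _ _ hc),
    by simp [c], fun s hs => ⟨?_, fun hs0 => ?_⟩⟩
  · have h1 : c s ≤ |B| + 1 := by
      have h3 : c s ≤ B := (le_abs_self (c s)).trans (hB s hs)
      linarith [le_abs_self B]
    have h2 : (|B| + 1)⁻¹ * c s ≤ 1 := by
      rw [inv_mul_le_iff₀ (by positivity)]
      linarith
    simpa using h2
  · have h1 : 0 < c s := by
      obtain ⟨i, hi⟩ : ∃ i, s i ≠ 0 := by
        by_contra! hall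
        exact hs0 (by ext i; simpa using hall i)
      exact Finset.sum_pos' (fun i _ => sub_nonneg.2 (Real.one_le_cosh _))
        ⟨i, Finset.mem_univ i, sub_pos.2 (Real.one_lt_cosh.2 hi)⟩
    have : 0 < (|B| + 1)⁻¹ * c s := by positivity
    simpa using this

/-- Every `C^k` function is a limit of linear combinations of exponentials. -/
theorem contDiff_mem_ckClosure_expSpan {d k : ℕ} {f : EuclideanSpace ℝ (Fin d) → ℝ}
    (hf : ContDiff ℝ k f) : f ∈ ckClosure k (expSpan (EuclideanSpace ℝ (Fin d))) := by
  refine mem_ckClosure_of_approx hf fun ρ ε hρ hε => ?_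
  obtain ⟨τ, hτ, hτc, hτe⟩ := exists_hasCompactSupport_eq hf ρ
  obtain ⟨R, hR⟩ : ∃ R : ℝ, ∀ y, R ≤ ‖y‖ → τ y = 0 := by
    obtain ⟨R, hR⟩ := hτc.isCompact.isBounded.subset_ball 0
    refine ⟨R, fun y hy => ?_⟩
    by_contra h
    have := hR (subset_tsupport _ h)
    rw [mem_ball_zero_iff] at this
    linarith
  obtain ⟨M, hM0, hM⟩ := exists_norm_iteratedFDeriv_le hτ hτc
  obtain ⟨δ, hδ, hδτ⟩ := exists_norm_iteratedFDeriv_sub_le hτ hτc (half_pos hε)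
  set r := max (ρ + R) 1
  set B := closedBall (0 : EuclideanSpace ℝ (Fin d)) r
  have hr : 0 < r := by positivity
  obtain ⟨h, hh, h0, hB⟩ := exists_mem_expSpan_peak d r
  have hhc : Continuous h := (contDiff_of_mem_expSpan (n := 0) hh).continuous
  have hBc : IsCompact B := isCompact_closedBall _ _
  have peak : ∀ g : EuclideanSpace ℝ (Fin d) → ℝ, Continuous g →
      Tendsto (fun n : ℕ => (∫ s in B, h s ^ n)⁻¹ • ∫ s in B, h s ^ n • g s) atTop (𝓝 (g 0)) := by
    intro g hg
    refine tendsto_setIntegral_pow_smul_of_unique_maximum_of_isCompact_of_continuousOn hBc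
      hhc.continuousOn (fun y hy hy0 => ?_) (fun y hy => (hB y hy).1) (by rw [h0]; exact one_pos)
      ?_ hg.continuousOn
    · rw [h0]; exact (hB y hy).2 hy0
    · refine subset_closure (interior_mono ball_subset_closedBall ?_)
      rw [isOpen_ball.interior_eq]
      exact mem_ball_self hr
  -- `G` dominates the change of every derivative of `τ` under a shift by `s`: by uniform continuity
  -- if `‖s‖ ≤ δ`, by the crude bound `2 * M` otherwise. Its averages against the concentrating
  -- kernel tend to `G 0 = ε / 2`.
  let G : EuclideanSpace ℝ (Fin d) → ℝ := fun s => ε / 2 + 2 * M / δ * ‖s‖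
  have hGc : Continuous G := continuous_const.add (continuous_const.mul continuous_norm)
  have hG0 : G 0 < ε := by
    simp only [G, norm_zero, mul_zero, add_zero]
    linarith
  have ev1 := (peak G hGc).eventually (gt_mem_nhds hG0)
  -- Only used to ensure that the normalizing integral `Z` is nonzero.
  have ev2 := (peak 1 continuous_const).eventually (lt_mem_nhds (a := 0) one_pos)
  obtain ⟨n, hn1, hn2⟩ := (ev1.and ev2).exists
  set Z := ∫ s in B, h s ^ n with hZ
  have hZne : Z ≠ 0 := by
    intro hz
    rw [hz] at hn2
    simp at hn2
  have hZ0 : 0 ≤ Z := setIntegral_nonneg hBc.measurableSet fun s hs => pow_nonneg (hB s hs).1 n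
  set κ : EuclideanSpace ℝ (Fin d) → ℝ := fun s => Z⁻¹ * h s ^ n with hκdef
  have hκc : Continuous κ := continuous_const.mul (hhc.pow n)
  have hκ : Integrable κ (volume.restrict B) := hκc.continuousOn.integrableOn_compact hBc
  have hκ0 : ∀ s ∈ B, 0 ≤ κ s := fun s hs => mul_nonneg (inv_nonneg.2 hZ0) (pow_nonneg (hB s hs).1 n)
  have hκmem : κ ∈ expSpan (EuclideanSpace ℝ (Fin d)) :=
    Submodule.smul_mem _ Z⁻¹ (pow_mem_expSpan hh n)
  have hgmem := integral_mul_mem_expSpan (μ := volume) hτ.continuous hτc hκmem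
  refine ⟨_, mem_ckClosure_of_mem hgmem (contDiff_of_mem_expSpan hgmem), fun j hj x hx => ?_⟩
  have e1 : ∀ t ∈ ball (0 : EuclideanSpace ℝ (Fin d)) ρ,
      f t = ∫ s in B, κ s • τ (t - (fun _ => (0 : EuclideanSpace ℝ (Fin d))) s) := by
    intro t ht
    simp only [sub_zero, smul_eq_mul, hκdef]
    rw [integral_mul_const, integral_const_mul, ← hZ, inv_mul_cancel₀ hZne, one_mul, hτe t ht]
  -- For `s` outside `B` one has `‖t - s‖ ≥ R`, so `τ (t - s) = 0`. The average over `B` is thus a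
  -- full convolution, which stays in `expSpan`.
  have e2 : ∀ t ∈ ball (0 : EuclideanSpace ℝ (Fin d)) ρ,
      ∫ y, κ (t - y) * τ y = ∫ s in B, κ s • τ (t - id s) := by
    intro t ht
    rw [mem_ball_zero_iff] at ht
    rw [setIntegral_eq_integral_of_forall_compl_eq_zero,
      ← integral_sub_left_eq_self (fun y => κ (t - y) * τ y) volume t]
    · simp
    · intro s hs
      have hs' : r < ‖s‖ := by simpa [B] using hs
      have h1 : R ≤ ‖t - s‖ := by
        have h2 := norm_sub_norm_le s t
        rw [norm_sub_rev] at h2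
        linarith [le_max_left (ρ + R) 1]
      rw [id, hR _ h1, smul_zero]
  have e3 : (f - fun x => ∫ y, κ (x - y) * τ y) =ᶠ[𝓝 x]
      ((fun t => ∫ s in B, κ s • τ (t - (fun _ => (0 : EuclideanSpace ℝ (Fin d))) s)) -
        fun t => ∫ s in B, κ s • τ (t - id s)) := by
    filter_upwards [isOpen_ball.mem_nhds hx] with t ht
    rw [Pi.sub_apply, Pi.sub_apply, e1 t ht, e2 t ht]
  rw [(e3.iteratedFDeriv ℝ j).eq_of_nhds]
  refine (norm_iteratedFDeriv_integral_translate_sub_le hτ hτc hκ measurable_const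
    measurable_id hj x).trans ?_
  have hG : ∀ s, ‖iteratedFDeriv ℝ j τ (x - 0) - iteratedFDeriv ℝ j τ (x - id s)‖ ≤ G s := by
    intro s
    rcases le_or_gt ‖s‖ δ with hs | hs
    · refine (hδτ j hj _ _ (by simpa using hs)).trans ?_
      have : 0 ≤ 2 * M / δ * ‖s‖ := by positivity
      simp only [G]
      linarith
    · refine (norm_sub_le _ _).trans ?_
      have h1 : 2 * M ≤ 2 * M / δ * ‖s‖ := by
        rw [div_mul_eq_mul_div, le_div_iff₀ hδ]
        gcongr
      simp only [G]
      linarith [hM j hj (x - 0), hM j hj (x - id s)]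
  calc _ ≤ ∫ s in B, κ s * G s := by
        refine integral_mono_of_nonneg (Eventually.of_forall fun s => by positivity)
          ((hκc.mul hGc).continuousOn.integrableOn_compact hBc) ?_
        refine (ae_restrict_iff' hBc.measurableSet).2 (Eventually.of_forall fun s hs => ?_)
        simp only
        rw [Real.norm_of_nonneg (hκ0 s hs)]
        exact mul_le_mul_of_nonneg_left (hG s) (hκ0 s hs)
    _ = Z⁻¹ • ∫ s in B, h s ^ n • G s := by
        simp only [hκdef, mul_assoc, integral_const_mul, smul_eq_mul]
    _ ≤ ε := hn1.le

/-- Linear combinations of ridge functions with an activation function that is not a polynomial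
are dense in the `C^k` functions. -/
theorem contDiff_mem_ckClosure_ridgeSpan {d k : ℕ} {σ : ℝ → ℝ} (hσ : ContDiff ℝ k σ)
    (hσp : ¬ ∃ P : Polynomial ℝ, ∀ t : ℝ, σ t = P.eval t) {f : EuclideanSpace ℝ (Fin d) → ℝ}
    (hf : ContDiff ℝ k f) : f ∈ ckClosure k (ridgeSpan (EuclideanSpace ℝ (Fin d)) σ) := by
  refine ckClosure_le_of_le ?_ (contDiff_mem_ckClosure_expSpan hf)
  refine Submodule.span_le.2 ?_
  rintro _ ⟨p, rfl⟩
  have h := comp_affine_mem_ckClosure_ridgeSpan p 0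
    (exp_mem_ckClosure (pow_mem_ckClosure hσ hσp))
  simpa using h

end Exponentials

/-! ### Density of deep networks -/

section Networks

theorem exists_sum_of_mem_ridgeSpan {E : Type*} [NormedAddCommGroup E] [NormedSpace ℝ E]
    {σ : ℝ → ℝ} {g : E → ℝ} (hg : g ∈ ridgeSpan E σ) :
    ∃ (p : ℕ) (A : Fin p → E →L[ℝ] ℝ) (b c : Fin p → ℝ), 0 < p ∧
      ∀ x, g x = ∑ q, σ (A q x + b q) * c q := by
  obtain ⟨p, c, s, hs⟩ := Submodule.mem_span_set'.1 hg
  choose A hA using fun q => (s q).2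
  -- A neuron with output coefficient zero is added, so that the width is positive even for an empty
  -- sum.
  refine ⟨p + 1, Fin.cons 0 fun q => (A q).1, Fin.cons 0 fun q => (A q).2, Fin.cons 0 c,
    Nat.succ_pos p, fun x => ?_⟩
  rw [← hs, Finset.sum_apply, Fin.sum_univ_succ]
  simp only [Fin.cons_zero, mul_zero, zero_add, Fin.cons_succ, Pi.smul_apply, smul_eq_mul]
  refine Finset.sum_congr rfl fun q _ => ?_
  rw [← hA q, mul_comm]

/-- Apply to the output of a network a network of depth one. -/
def Network.snoc {p : ℕ} (w b c : Fin p → ℝ) :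
    {m : ℕ} → {l : List ℕ} → Network m l → Network m (l ++ [p])
  | _, _, .output c₀ => .layer (fun i q => c₀ i * w q) b (.output c)
  | _, _, .layer W b' N => .layer W b' (N.snoc w b c)

theorem Network.eval_snoc (σ : ℝ → ℝ) {p : ℕ} (w b c : Fin p → ℝ) {m : ℕ} {l : List ℕ}
    (N : Network m l) (t : Fin m → ℝ) :
    (N.snoc w b c).eval σ t = ∑ q, σ (w q * N.eval σ t + b q) * c q := by
  induction N with
  | output c₀ =>
    change ∑ q, σ (∑ i, t i * (c₀ i * w q) + b q) * c q =
      ∑ q, σ (w q * (∑ i, t i * c₀ i) + b q) * c q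
    refine Finset.sum_congr rfl fun q _ => ?_
    rw [Finset.mul_sum]
    congr 3
    exact Finset.sum_congr rfl fun i _ => by ring
  | layer W b' N ih => exact ih _

/-- Multiply the output of a network by a constant. -/
def Network.scale (τ : ℝ) : {m : ℕ} → {l : List ℕ} → Network m l → Network m l
  | _, _, .output c => .output (τ • c)
  | _, _, .layer W b N => .layer W b (N.scale τ)

theorem Network.eval_scale (σ : ℝ → ℝ) (τ : ℝ) {m : ℕ} {l : List ℕ} (N : Network m l)
    (t : Fin m → ℝ) : (N.scale τ).eval σ t = τ * N.eval σ t := by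
  induction N with
  | output c =>
    change ∑ i, t i * (τ * c i) = τ * ∑ i, t i * c i
    rw [Finset.mul_sum]
    exact Finset.sum_congr rfl fun i _ => by ring
  | layer W b N ih => exact ih _

theorem Network.size_nonneg {m : ℕ} {l : List ℕ} (N : Network m l) : 0 ≤ N.size := by
  induction N with
  | output c => exact norm_nonneg c
  | layer W b N ih =>
    change 0 ≤ ‖W‖ + ‖b‖ + N.size
    positivity

theorem Network.size_scale_le {τ T : ℝ} (hτ : |τ| ≤ T) {m : ℕ} {l : List ℕ} (N : Network m l) :
    (N.scale τ).size ≤ (T + 1) * N.size := by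
  have hT : 0 ≤ T := (abs_nonneg τ).trans hτ
  induction N with
  | output c =>
    change ‖τ • c‖ ≤ (T + 1) * ‖c‖
    rw [norm_smul, Real.norm_eq_abs]
    gcongr
    linarith
  | layer W b N ih =>
    change ‖W‖ + ‖b‖ + (N.scale τ).size ≤ (T + 1) * (‖W‖ + ‖b‖ + N.size)
    have h1 : 0 ≤ T * (‖W‖ + ‖b‖) := by positivity
    linarith

/-- The networks of a given architecture are parametrized by a finite dimensional space. -/
theorem exists_network_parametrization {k : ℕ} {σ : ℝ → ℝ} (hσ : ContDiff ℝ k σ) (l : List ℕ) :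
    ∀ m : ℕ, ∃ (P : Type) (_ : NormedAddCommGroup P) (_ : NormedSpace ℝ P)
      (_ : FiniteDimensional ℝ P) (net : P → Network m l), Function.Surjective net ∧
      Continuous (fun θ => (net θ).size) ∧ (∀ θ, ‖θ‖ ≤ (net θ).size) ∧
      ContDiff ℝ k fun z : P × (Fin m → ℝ) => (net z.1).eval σ z.2 := by
  induction l with
  | nil =>
    refine fun m => ⟨Fin m → ℝ, inferInstance, inferInstance, inferInstance, Network.output,
      fun N => ?_, continuous_norm, fun θ => le_rfl, ?_⟩
    · cases N with
      | output c => exact ⟨c, rfl⟩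
    · change ContDiff ℝ k fun z : (Fin m → ℝ) × (Fin m → ℝ) => ∑ i, z.2 i * z.1 i
      fun_prop
  | cons p l ih =>
    intro m
    obtain ⟨P, _, _, _, net, hsurj, hcont, hnorm, hsm⟩ := ih p
    refine ⟨(Fin m → Fin p → ℝ) × (Fin p → ℝ) × P, inferInstance, inferInstance, inferInstance,
      fun θ => .layer θ.1 θ.2.1 (net θ.2.2), fun N => ?_, ?_, fun θ => ?_, ?_⟩
    · cases N with
      | layer W b N =>
        obtain ⟨θ, rfl⟩ := hsurj N
        exact ⟨(W, b, θ), rfl⟩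
    · change Continuous fun θ : (Fin m → Fin p → ℝ) × (Fin p → ℝ) × P =>
        ‖θ.1‖ + ‖θ.2.1‖ + (net θ.2.2).size
      exact (continuous_fst.norm.add continuous_snd.fst.norm).add (hcont.comp continuous_snd.snd)
    · change ‖θ‖ ≤ ‖θ.1‖ + ‖θ.2.1‖ + (net θ.2.2).size
      have h1 := hnorm θ.2.2
      have h2 := norm_nonneg θ.1
      have h3 := norm_nonneg θ.2.1
      have h4 := norm_nonneg θ.2.2
      refine max_le (by linarith) (max_le (by linarith) (by linarith))
    · change ContDiff ℝ k fun z : ((Fin m → Fin p → ℝ) × (Fin p → ℝ) × P) × (Fin m → ℝ) =>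
        (net z.1.2.2).eval σ fun q => σ (∑ i, z.2 i * z.1.1 i q + z.1.2.1 q)
      refine hsm.comp (ContDiff.prodMk (by fun_prop) (contDiff_pi.2 fun q => hσ.comp ?_))
      fun_prop

theorem Network.contDiff_eval {k : ℕ} {σ : ℝ → ℝ} (hσ : ContDiff ℝ k σ) {d : ℕ} {l : List ℕ}
    (N : Network d l) :
    ContDiff ℝ k fun x : EuclideanSpace ℝ (Fin d) => N.eval σ fun i => x i := by
  obtain ⟨P, _, _, _, net, hsurj, -, -, hsm⟩ := exists_network_parametrization hσ l d
  obtain ⟨θ, rfl⟩ := hsurj N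
  exact hsm.comp (contDiff_const.prodMk (by fun_prop))

/-- Networks of any fixed depth are dense in the `C^k` functions, in `C^k` on bounded sets. -/
theorem exists_network_approx {d k : ℕ} {σ : ℝ → ℝ} (hσ : ContDiff ℝ k σ)
    (hσp : ¬ ∃ P : Polynomial ℝ, ∀ t : ℝ, σ t = P.eval t) {f : EuclideanSpace ℝ (Fin d) → ℝ}
    (hf : ContDiff ℝ k f) (ρ : ℝ) {L : ℕ} (hL : 1 ≤ L) : ∀ ε : ℝ, 0 < ε →
      ∃ (n : List ℕ) (N : Network d n), n.length = L ∧ (∀ w ∈ n, 0 < w) ∧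
        ∀ j ≤ k, ∀ x ∈ ball (0 : EuclideanSpace ℝ (Fin d)) ρ,
          ‖iteratedFDeriv ℝ j (f - fun x => N.eval σ fun i => x i) x‖ ≤ ε := by
  induction L, hL using Nat.le_induction with
  | base =>
    intro ε hε
    obtain ⟨g, hg, -, h⟩ := (contDiff_mem_ckClosure_ridgeSpan hσ hσp hf).2 ρ ε hε
    obtain ⟨p, A, b, c, hp, hgA⟩ := exists_sum_of_mem_ridgeSpan hg
    refine ⟨[p], .layer (fun i q => A q (EuclideanSpace.single i 1)) b (.output c), rfl,
      by simpa using hp, ?_⟩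
    have hNg : (fun x : EuclideanSpace ℝ (Fin d) => (Network.layer
        (fun i q => A q (EuclideanSpace.single i 1)) b (.output c)).eval σ fun i => x i) = g := by
      ext x
      rw [hgA]
      change ∑ q, σ (∑ i, x i * A q (EuclideanSpace.single i 1) + b q) * c q = _
      refine Finset.sum_congr rfl fun q _ => ?_
      congr 3
      conv_rhs => rw [← (EuclideanSpace.basisFun (Fin d) ℝ).sum_repr x, map_sum]
      simp
    rw [hNg]
    exact h
  | succ L hL ih =>
    intro ε hε
    obtain ⟨n, N, hnL, hn0, hN⟩ := ih (ε / 2) (half_pos hε)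
    set F : EuclideanSpace ℝ (Fin d) → ℝ := fun x => N.eval σ fun i => x i with hF
    have hFc : ContDiff ℝ k F := N.contDiff_eval hσ
    have hb : ∀ j : ℕ, ∃ C : ℝ, j ≤ k → ∀ x ∈ closedBall (0 : EuclideanSpace ℝ (Fin d)) ρ,
        ‖iteratedFDeriv ℝ j F x‖ ≤ C := fun j => by
      by_cases hj : j ≤ k
      · obtain ⟨C, hC⟩ := (isCompact_closedBall (0 : EuclideanSpace ℝ (Fin d))
          ρ).exists_bound_of_continuousOn
          (hFc.continuous_iteratedFDeriv (m := j) (by exact_mod_cast hj)).continuousOn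
        exact ⟨C, fun _ => hC⟩
      · exact ⟨0, fun h => absurd h hj⟩
    choose C hC using hb
    set D : ℝ := 1 + ∑ j ∈ Finset.range (k + 1), |C j| with hD
    have hD1 : 1 ≤ D := by
      have : 0 ≤ ∑ j ∈ Finset.range (k + 1), |C j| := by positivity
      linarith
    have hCD : ∀ j ≤ k, ∀ x ∈ ball (0 : EuclideanSpace ℝ (Fin d)) ρ,
        ‖iteratedFDeriv ℝ j F x‖ ≤ D := fun j hj x hx => by
      have h1 : |C j| ≤ ∑ j ∈ Finset.range (k + 1), |C j| :=
        Finset.single_le_sum (f := fun j => |C j|) (fun _ _ => abs_nonneg _)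
          (Finset.mem_range.2 (by omega))
      linarith [hC j hj x (ball_subset_closedBall hx), le_abs_self (C j)]
    -- `g` is a shallow network close to the identity on the range of `F`, and `f - g ∘ F = (f - F)
    -- + (id - g) ∘ F`. The Faà di Bruno bound for the last term costs at most `k! * D ^ k`, where
    -- `D ≥ 1` bounds `F` and its derivatives.
    obtain ⟨g, hg, hgc, h⟩ := (pow_mem_ckClosure hσ hσp 1).2 (D + 1)
      (ε / 2 / (k.factorial * D ^ k)) (by positivity)
    obtain ⟨p, A, b, c, hp, hgA⟩ := exists_sum_of_mem_ridgeSpan hg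
    have hsnoc : (fun x : EuclideanSpace ℝ (Fin d) =>
        (N.snoc (fun q => A q 1) b c).eval σ fun i => x i) = fun x => g (F x) := by
      ext x
      rw [Network.eval_snoc, hgA]
      refine Finset.sum_congr rfl fun q _ => ?_
      congr 3
      conv_rhs => rw [← mul_one (F x), ← smul_eq_mul, map_smul, smul_eq_mul, mul_comm]
    refine ⟨n ++ [p], N.snoc (fun q => A q 1) b c, by simp [hnL], ?_, fun j hj x hx => ?_⟩
    · intro w hw
      rcases List.mem_append.1 hw with hw | hw
      · exact hn0 w hw
      · rw [List.mem_singleton.1 hw]; exact hp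
    · have hjk : (j : WithTop ℕ∞) ≤ k := by exact_mod_cast hj
      set e : ℝ → ℝ := (fun t => t ^ 1) - g with he
      have hec : ContDiff ℝ k e := (contDiff_id.pow 1).sub hgc
      have hsplit : (f - fun x => (N.snoc (fun q => A q 1) b c).eval σ fun i => x i) =
          (f - F) + e ∘ F := by
        rw [hsnoc]
        ext y
        simp [he]
      rw [hsplit, iteratedFDeriv_add_apply (f := f - F) ((hf.sub hFc).of_le hjk).contDiffAt
        ((hec.comp hFc).of_le hjk).contDiffAt]
      refine (norm_add_le _ _).trans ?_
      have hFx : F x ∈ ball (0 : ℝ) (D + 1) := by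
        rw [mem_ball_zero_iff]
        have := hCD 0 (by omega) x hx
        rw [norm_iteratedFDeriv_zero] at this
        linarith
      have h1 := norm_iteratedFDeriv_comp_le hec hFc hjk x
        (C := ε / 2 / (k.factorial * D ^ k)) (D := D)
        (fun i hi => h i (hi.trans hj) _ hFx)
        (fun i hi1 hi => (hCD i (hi.trans hj) x hx).trans (le_self_pow₀ hD1 (by omega)))
      have h2 : j.factorial * (ε / 2 / (k.factorial * D ^ k)) * D ^ j ≤ ε / 2 := by
        calc _ ≤ k.factorial * (ε / 2 / (k.factorial * D ^ k)) * D ^ k := by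
              have hfac : (j.factorial : ℝ) ≤ k.factorial := by
                exact_mod_cast Nat.factorial_le hj
              have hpow : D ^ j ≤ D ^ k := pow_le_pow_right₀ hD1 hj
              gcongr
          _ = ε / 2 := by field_simp
      linarith [hN j hj x hx]

end Networks

/-! ### Approximation sets in the function space -/

namespace FunctionSpace

variable {d : ℕ} {Ω : Set (EuclideanSpace ℝ (Fin d))} {k : ℕ}
  {X : Type*} [NormedAddCommGroup X] [InnerProductSpace ℝ X] {S : FunctionSpace Ω k X}

theorem Represents.unique {v w : X} {f : EuclideanSpace ℝ (Fin d) → ℝ} (hv : S.Represents v f)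
    (hw : S.Represents w f) : v = w :=
  S.injective (AEEqFun.ext (hv.trans hw.symm))

theorem Represents.zero : S.Represents 0 0 := by
  unfold Represents
  rw [map_zero]
  exact AEEqFun.coeFn_zero

theorem Represents.add {v w : X} {f g : EuclideanSpace ℝ (Fin d) → ℝ} (hv : S.Represents v f)
    (hw : S.Represents w g) : S.Represents (v + w) (f + g) := by
  unfold Represents
  rw [map_add]
  exact (AEEqFun.coeFn_add _ _).trans (EventuallyEq.add hv hw)

theorem Represents.smul (c : ℝ) {v : X} {f : EuclideanSpace ℝ (Fin d) → ℝ}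
    (hv : S.Represents v f) : S.Represents (c • v) (c • f) := by
  unfold Represents
  rw [map_smul]
  exact (AEEqFun.coeFn_smul _ _).trans (EventuallyEq.const_smul hv c)

theorem Represents.sub {v w : X} {f g : EuclideanSpace ℝ (Fin d) → ℝ} (hv : S.Represents v f)
    (hw : S.Represents w g) : S.Represents (v - w) (f - g) := by
  unfold Represents
  rw [map_sub]
  exact (AEEqFun.coeFn_sub _ _).trans (EventuallyEq.sub hv hw)

theorem Represents.sum {ι : Type*} (s : Finset ι) {v : ι → X}
    {f : ι → EuclideanSpace ℝ (Fin d) → ℝ} (h : ∀ i, S.Represents (v i) (f i)) :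
    S.Represents (∑ i ∈ s, v i) (∑ i ∈ s, f i) := by
  classical
  induction s using Finset.induction_on with
  | empty => simpa using Represents.zero
  | insert i s hi ih =>
    rw [Finset.sum_insert hi, Finset.sum_insert hi]
    exact (h i).add ih

variable (S) in
/-- The elements of `X` that are `C^k` functions. -/
def smoothSubmodule : Submodule ℝ X where
  carrier := {v | ∃ f : EuclideanSpace ℝ (Fin d) → ℝ, ContDiff ℝ k f ∧ S.Represents v f}
  zero_mem' := ⟨0, contDiff_const, Represents.zero⟩
  add_mem' := by
    rintro v w ⟨f, hf, hv⟩ ⟨g, hg, hw⟩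
    exact ⟨f + g, ContDiff.add hf hg, hv.add hw⟩
  smul_mem' := by
    rintro c v ⟨f, hf, hv⟩
    exact ⟨c • f, contDiff_const.smul hf, hv.smul c⟩

theorem networkSet_subset_smoothSubmodule {σ : ℝ → ℝ} (hσ : ContDiff ℝ k σ) (n : List ℕ) (C : ℝ) :
    S.networkSet σ n C ⊆ S.smoothSubmodule := by
  rintro v ⟨N, -, hv⟩
  exact ⟨_, N.contDiff_eval hσ, hv⟩

/-- Functions depending smoothly on a parameter depend on it continuously in `X`. -/
theorem continuous_of_represents (hΩb : Bornology.IsBounded Ω) {P : Type*} [NormedAddCommGroup P]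
    [NormedSpace ℝ P] {F : P × EuclideanSpace ℝ (Fin d) → ℝ} (hF : ContDiff ℝ k F) {rep : P → X}
    (hrep : ∀ θ, S.Represents (rep θ) fun x => F (θ, x)) : Continuous rep := by
  obtain ⟨C, hC⟩ := S.exists_norm_le
  have hsec : ∀ θ, ContDiff ℝ k fun x => F (θ, x) := fun θ =>
    hF.comp (contDiff_const.prodMk contDiff_id)
  let I := ContinuousLinearMap.inr ℝ P (EuclideanSpace ℝ (Fin d))
  have hder : ∀ θ, ∀ j ≤ k, ∀ x, iteratedFDeriv ℝ j (fun x => F (θ, x)) x =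
      (iteratedFDeriv ℝ j F (θ, x)).compContinuousLinearMap fun _ => I := by
    intro θ j hj x
    have e : (fun x => F (θ, x)) = (fun z => F (z + (θ, 0))) ∘ I := by
      ext x
      simp [I]
    have hc : ContDiff ℝ k fun z => F (z + (θ, 0)) :=
      hF.comp (contDiff_id.add contDiff_const)
    rw [e, I.iteratedFDeriv_comp_right hc x (by exact_mod_cast hj), iteratedFDeriv_comp_add_right]
    simp [I]
  rw [continuous_iff_continuousAt]
  intro θ₀
  rw [ContinuousAt, Metric.tendsto_nhds]
  intro ε hε
  set η := ε / (|C| + 1) / 2 with hη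
  have hη0 : 0 < η := by positivity
  have hcpt : IsCompact (closure Ω) := hΩb.isCompact_closure
  -- Compactness of `closure Ω` makes the continuity in the parameter uniform in `x`.
  have hev : ∀ j ∈ Finset.range (k + 1), ∀ᶠ θ in 𝓝 θ₀, ∀ x ∈ closure Ω,
      ‖iteratedFDeriv ℝ j F (θ, x) - iteratedFDeriv ℝ j F (θ₀, x)‖ * ‖I‖ ^ j ≤ η := by
    intro j hj
    have hj' : j ≤ k := by simpa [Nat.lt_succ_iff] using hj
    have hcont := hF.continuous_iteratedFDeriv (m := j) (by exact_mod_cast hj')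
    refine hcpt.eventually_forall_of_forall_eventually fun x _ => ?_
    have ht : Tendsto (fun z : P × EuclideanSpace ℝ (Fin d) =>
        ‖iteratedFDeriv ℝ j F (z.1, z.2) - iteratedFDeriv ℝ j F (θ₀, z.2)‖ * ‖I‖ ^ j)
        (𝓝 (θ₀, x)) (𝓝 (‖iteratedFDeriv ℝ j F (θ₀, x) - iteratedFDeriv ℝ j F (θ₀, x)‖ * ‖I‖ ^ j)) :=
      (((hcont.sub (hcont.comp (continuous_const.prodMk continuous_snd))).norm.mul
        continuous_const).tendsto (θ₀, x))
    rw [sub_self, norm_zero, zero_mul] at ht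
    exact (ht.eventually (gt_mem_nhds hη0)).mono fun z hz => hz.le
  filter_upwards [(Finset.eventually_all _).2 hev] with θ hθ
  rw [dist_eq_norm]
  have h1 : ‖rep θ - rep θ₀‖ ≤ C * η := by
    refine hC _ _ ((hsec θ).sub (hsec θ₀)) ((hrep θ).sub (hrep θ₀)) η hη0.le fun j hj x hx => ?_
    have hjk : (j : WithTop ℕ∞) ≤ k := by exact_mod_cast hj
    have h2 : iteratedFDeriv ℝ j (fun x => F (θ, x) - F (θ₀, x)) x =
        (iteratedFDeriv ℝ j F (θ, x) - iteratedFDeriv ℝ j F (θ₀, x)).compContinuousLinearMap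
          fun _ => I := by
      change iteratedFDeriv ℝ j ((fun x => F (θ, x)) - fun x => F (θ₀, x)) x = _
      rw [iteratedFDeriv_sub_apply ((hsec θ).of_le hjk).contDiffAt
        ((hsec θ₀).of_le hjk).contDiffAt, hder θ j hj, hder θ₀ j hj]
      rfl
    rw [h2]
    refine (ContinuousMultilinearMap.norm_compContinuousLinearMap_le _ _).trans ?_
    rw [Finset.prod_const, Finset.card_univ, Fintype.card_fin]
    exact hθ j (Finset.mem_range.2 (by omega)) x (subset_closure hx)
  calc ‖rep θ - rep θ₀‖ ≤ C * η := h1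
    _ ≤ (|C| + 1) * η := by gcongr; linarith [le_abs_self C]
    _ = ε / 2 := by rw [hη]; field_simp
    _ < ε := half_lt_self hε

/-- Networks of a fixed architecture with bounded parameters form a compact set. -/
theorem isCompact_networkSet (hΩb : Bornology.IsBounded Ω) {σ : ℝ → ℝ} (hσ : ContDiff ℝ k σ)
    (n : List ℕ) (C : ℝ) : IsCompact (S.networkSet σ n C) := by
  obtain ⟨P, _, _, _, net, hsurj, hcont, hnorm, hsm⟩ := exists_network_parametrization hσ n d
  have : ProperSpace P := FiniteDimensional.proper ℝ P
  choose rep hrep using fun θ => S.exists_of_contDiff _ ((net θ).contDiff_eval hσ)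
  have hrepc : Continuous rep := continuous_of_represents hΩb
    (F := fun z => (net z.1).eval σ fun i => z.2 i)
    (hsm.comp (contDiff_fst.prodMk (by fun_prop))) hrep
  have himg : S.networkSet σ n C = rep '' {θ | (net θ).size ≤ C} := by
    ext v
    constructor
    · rintro ⟨N, hN, hv⟩
      obtain ⟨θ, rfl⟩ := hsurj N
      exact ⟨θ, hN, Represents.unique (S := S) (hrep θ) hv⟩
    · rintro ⟨θ, hθ, rfl⟩
      exact ⟨net θ, hθ, hrep θ⟩
  rw [himg]
  refine IsCompact.image ?_ hrepc
  refine (isCompact_closedBall (0 : P) C).of_isClosed_subset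
    (isClosed_le hcont continuous_const) fun θ hθ => ?_
  rw [mem_closedBall_zero_iff]
  exact (hnorm θ).trans hθ

/-- Networks of a fixed depth are dense in the regular part of `X`. -/
theorem exists_network_norm_sub_le (hΩb : Bornology.IsBounded Ω) {σ : ℝ → ℝ} (hσ : ContDiff ℝ k σ)
    (hσp : ¬ ∃ P : Polynomial ℝ, ∀ t : ℝ, σ t = P.eval t) {L : ℕ} (hL : 1 ≤ L) {v : X}
    (hv : v ∈ S.regularPart) {ε : ℝ} (hε : 0 < ε) :
    ∃ (n : List ℕ) (N : Network d n) (w : X), n.length = L ∧ (∀ m ∈ n, 0 < m) ∧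
      (S.Represents w fun x => N.eval σ fun i => x i) ∧ ‖v - w‖ ≤ ε := by
  obtain ⟨v', ⟨f, hf, hv'⟩, hvv'⟩ := Metric.mem_closure_iff.1 hv (ε / 2) (half_pos hε)
  obtain ⟨C, hC⟩ := S.exists_norm_le
  obtain ⟨ρ, hρ⟩ := hΩb.subset_ball 0
  obtain ⟨n, N, hnL, hn0, hN⟩ := exists_network_approx hσ hσp hf ρ hL (ε / 2 / (|C| + 1))
    (by positivity)
  obtain ⟨w, hw⟩ := S.exists_of_contDiff _ (N.contDiff_eval hσ)
  refine ⟨n, N, w, hnL, hn0, hw, ?_⟩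
  have h1 := hC (v' - w) _ (hf.sub (N.contDiff_eval hσ)) (Represents.sub (S := S) hv' hw)
    (ε / 2 / (|C| + 1)) (by positivity) fun j hj x hx => hN j hj x (hρ hx)
  have h2 : C * (ε / 2 / (|C| + 1)) ≤ ε / 2 := by
    calc _ ≤ (|C| + 1) * (ε / 2 / (|C| + 1)) := by gcongr; linarith [le_abs_self C]
      _ = ε / 2 := by field_simp
  rw [dist_eq_norm] at hvv'
  calc ‖v - w‖ = ‖(v - v') + (v' - w)‖ := by rw [sub_add_sub_cancel]
    _ ≤ ε := by linarith [norm_add_le (v - v') (v' - w)]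

section Knowledge

variable {Ψ : EuclideanSpace ℝ (Fin d) → ℝ → ℝ} {M : ℕ} {lam : Fin M → ℝ}

theorem represents_linearCombination {ψ : Fin M → X}
    (hψ : ∀ j, S.Represents (ψ j) fun x => Ψ x (lam j)) (c : Fin M → ℝ) :
    S.Represents (Fintype.linearCombination ℝ ψ c) fun x => ∑ j, c j * Ψ x (lam j) := by
  have h := Represents.sum Finset.univ fun j => (hψ j).smul (c j)
  rw [Fintype.linearCombination_apply]
  convert h using 1
  ext x
  simp

theorem knowledgeSet_eq {ψ : Fin M → X} (hψ : ∀ j, S.Represents (ψ j) fun x => Ψ x (lam j)) :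
    S.knowledgeSet Ψ lam = (LinearMap.range (Fintype.linearCombination ℝ ψ) : Set X) := by
  ext v
  constructor
  · rintro ⟨c, hc⟩
    exact ⟨c, (represents_linearCombination hψ c).unique hc⟩
  · rintro ⟨c, rfl⟩
    exact ⟨c, represents_linearCombination hψ c⟩

theorem knowledgeSetBounded_eq {ψ : Fin M → X}
    (hψ : ∀ j, S.Represents (ψ j) fun x => Ψ x (lam j)) (C : ℝ) :
    S.knowledgeSetBounded Ψ lam C =
      Fintype.linearCombination ℝ ψ '' closedBall (0 : Fin M → ℝ) (C - ‖lam‖) := by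
  ext v
  simp only [mem_image, mem_closedBall_zero_iff, le_sub_iff_add_le]
  constructor
  · rintro ⟨c, hcC, hc⟩
    exact ⟨c, hcC, (represents_linearCombination hψ c).unique hc⟩
  · rintro ⟨c, hcC, rfl⟩
    exact ⟨c, hcC, represents_linearCombination hψ c⟩

theorem knowledgeSetBounded_subset (C : ℝ) :
    S.knowledgeSetBounded Ψ lam C ⊆ S.knowledgeSet Ψ lam := by
  rintro v ⟨c, -, hc⟩
  exact ⟨c, hc⟩

end Knowledge

end FunctionSpace

/-! ### Splitting off a finite dimensional space -/

section Decomposition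

variable {X : Type*} [NormedAddCommGroup X] [InnerProductSpace ℝ X] [CompleteSpace X]

/-- Sums `e₁ + e₂` with `e₁` in a closed subspace `R` and `e₂` in a finite dimensional subspace `K`
can be rearranged such that the first summand depends on `e₁` only and both are controlled by the
norm of the sum. -/
theorem exists_stable_decomposition {R K : Submodule ℝ X} (hR : IsClosed (R : Set X))
    [FiniteDimensional ℝ K] :
    ∃ c : ℝ, 0 ≤ c ∧ ∀ e₁ ∈ R, ∃ e ∈ R, ∀ e₂ ∈ K,
      e₁ + e₂ - e ∈ K ∧ ‖e‖ ≤ c * ‖e₁ + e₂‖ := by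
  have : CompleteSpace R := hR.completeSpace_coe
  -- Unbounded cancellation between `e₁` and `e₂` can only happen along `N`. The choice `e = e₁ - P
  -- e₁` moves that component to the second summand.
  let N : Submodule ℝ X := K ⊓ R
  have : FiniteDimensional ℝ N := Submodule.finiteDimensional_inf_left K R
  let K' : Submodule ℝ X := K ⊓ Nᗮ
  have : FiniteDimensional ℝ K' := Submodule.finiteDimensional_inf_left K Nᗮ
  let P := N.starProjection
  let Q := Rᗮ.starProjection
  have hQ : ∀ x, Q x = 0 ↔ x ∈ R := fun x => by
    rw [Submodule.starProjection_apply_eq_zero_iff, Submodule.orthogonal_orthogonal]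
  have hP : ∀ x, P x ∈ N := fun x => N.starProjection_apply_mem x
  -- `Q` has kernel `R`, which meets `K'` only in `0`; on the finite dimensional `K'` injectivity
  -- gives a lower bound.
  obtain ⟨c, -, hc⟩ := ((Q : X →ₗ[ℝ] X).comp K'.subtype).exists_antilipschitzWith (by
    rw [LinearMap.ker_eq_bot']
    rintro ⟨x, hxK, hxN⟩ hx
    have hxR : x ∈ R := (hQ x).1 hx
    have h0 : inner ℝ x x = 0 := hxN x ⟨hxK, hxR⟩
    exact Subtype.ext (inner_self_eq_zero.1 h0))
  refine ⟨2 + c, by positivity, fun e₁ he₁ => ⟨e₁ - P e₁, R.sub_mem he₁ (hP e₁).2,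
    fun e₂ he₂ => ⟨?_, ?_⟩⟩⟩
  · have : e₁ + e₂ - (e₁ - P e₁) = e₂ + P e₁ := by abel
    rw [this]
    exact K.add_mem he₂ (hP e₁).1
  · have hk : e₂ - P e₂ ∈ K' :=
      ⟨K.sub_mem he₂ (hP e₂).1, N.sub_starProjection_mem_orthogonal e₂⟩
    have h1 : ‖e₂ - P e₂‖ ≤ c * ‖Q (e₂ - P e₂)‖ := by
      have := hc.le_mul_dist (⟨_, hk⟩ : K') 0
      simpa [dist_eq_norm] using this
    have h2 : Q (e₂ - P e₂) = Q (e₁ + e₂) := by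
      rw [← sub_eq_zero, ← map_sub, hQ]
      have : e₂ - P e₂ - (e₁ + e₂) = -(e₁ + P e₂) := by abel
      rw [this]
      exact R.neg_mem (R.add_mem he₁ (hP e₂).2)
    have h3 : ‖Q (e₁ + e₂)‖ ≤ ‖e₁ + e₂‖ := Rᗮ.norm_starProjection_apply_le _
    have h4 : ‖P (e₁ + e₂)‖ ≤ ‖e₁ + e₂‖ := N.norm_starProjection_apply_le _
    -- The three terms are bounded by `1`, `c` and `1` times `‖e₁ + e₂‖`; the middle one because `Q`
    -- does not see `R`.
    have h5 : e₁ - P e₁ = (e₁ + e₂) - (e₂ - P e₂) - P (e₁ + e₂) := by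
      rw [map_add]
      abel
    rw [h2] at h1
    have h6 : (c : ℝ) * ‖Q (e₁ + e₂)‖ ≤ c * ‖e₁ + e₂‖ := by gcongr
    rw [h5]
    have h7 := norm_sub_le ((e₁ + e₂) - (e₂ - P e₂)) (P (e₁ + e₂))
    have h8 := norm_sub_le (e₁ + e₂) (e₂ - P e₂)
    linarith

end Decomposition

/-! ### Maximizers of the residual -/

section Maximizer

variable {X H : Type*} [NormedAddCommGroup X] [InnerProductSpace ℝ X]
  [NormedAddCommGroup H] [InnerProductSpace ℝ H]

/-- Normalizing moves `y` by `|1 - ‖y‖|`, which is at most `‖x - y‖` as `x` is a unit vector. The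
condition `η < 1` keeps `y` away from `0`. -/
theorem norm_sub_normalize_le {x y : H} {η : ℝ} (hx : ‖x‖ = 1) (hxy : ‖x - y‖ ≤ η) (hη : η < 1) :
    ‖x - ‖y‖⁻¹ • y‖ ≤ 2 * η := by
  have h1 := abs_norm_sub_norm_le x y
  rw [hx] at h1
  have hy : 0 < ‖y‖ := by linarith [(abs_le.1 (h1.trans hxy)).2]
  have h2 : ‖y - ‖y‖⁻¹ • y‖ = |1 - ‖y‖| := by
    have : y - ‖y‖⁻¹ • y = (1 - ‖y‖⁻¹) • y := by rw [sub_smul, one_smul]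
    rw [this, norm_smul, Real.norm_eq_abs, ← abs_of_pos hy, ← abs_mul, abs_of_pos hy, sub_mul,
      inv_mul_cancel₀ hy.ne', one_mul, abs_sub_comm]
  calc ‖x - ‖y‖⁻¹ • y‖ = ‖(x - y) + (y - ‖y‖⁻¹ • y)‖ := by rw [sub_add_sub_cancel]
    _ ≤ ‖x - y‖ + ‖y - ‖y‖⁻¹ • y‖ := norm_add_le _ _
    _ ≤ 2 * η := by rw [h2]; linarith

variable {a : X → X → ℝ} {F : X → ℝ} {T : X →L[ℝ] H} {u w : X} {A B : Set X}

theorem energyNorm_eq (ha : ∀ x y, a x y = inner ℝ (T x) (T y)) (v : X) :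
    energyNorm a v = ‖T v‖ := by
  rw [energyNorm, ha, real_inner_self_eq_norm_sq, Real.sqrt_sq (norm_nonneg _)]

theorem residual_eq (ha : ∀ x y, a x y = inner ℝ (T x) (T y)) (hu : ∀ v, a u v = F v) (v : X) :
    residual a F w v = inner ℝ (T (u - w)) (T v) := by
  rw [residual, ← hu, ha, ha, map_sub, inner_sub_left]

/-- A continuous function attains its maximum on a nonempty compact set; working with pairs in `A ×ˢ
B` yields the two summands of the maximizer. -/
theorem exists_isBasisFunction (ha : ∀ x y, a x y = inner ℝ (T x) (T y))
    (hu : ∀ v, a u v = F v) (hA : IsCompact A) (hB : IsCompact B)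
    (hne : ∃ p ∈ A, ∃ q ∈ B, energyNorm a (p + q) = 1) :
    ∃ p q : X, IsBasisFunction a F w A B p q := by
  let s : Set (X × X) := (A ×ˢ B) ∩ {z | ‖T (z.1 + z.2)‖ = 1}
  have hcont : Continuous fun z : X × X => T (z.1 + z.2) :=
    T.continuous.comp (continuous_fst.add continuous_snd)
  have hs : IsCompact s := (hA.prod hB).inter_right (isClosed_eq hcont.norm continuous_const)
  obtain ⟨p₀, hp₀, q₀, hq₀, h₀⟩ := hne
  rw [energyNorm_eq ha] at h₀
  obtain ⟨⟨p, q⟩, ⟨⟨hp, hq⟩, hpq⟩, hmax⟩ := hs.exists_isMaxOn ⟨(p₀, q₀), ⟨hp₀, hq₀⟩, h₀⟩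
    ((continuous_const (y := T (u - w))).inner hcont (𝕜 := ℝ)).continuousOn
  refine ⟨p, q, hp, hq, by rw [energyNorm_eq ha]; exact hpq, fun p' hp' q' hq' h' => ?_⟩
  rw [energyNorm_eq ha] at h'
  rw [residual_eq ha hu, residual_eq ha hu]
  exact hmax (a := (p', q')) ⟨⟨hp', hq'⟩, h'⟩

/-- A maximizer of the residual is a best approximation of the normalized error. -/
theorem IsBasisFunction.energyNorm_sub_le (ha : ∀ x y, a x y = inner ℝ (T x) (T y))
    (hu : ∀ v, a u v = F v) {p q : X} (h : IsBasisFunction a F w A B p q) (hne : T (u - w) ≠ 0)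
    {p₀ q₀ : X} (hp₀ : p₀ ∈ A) (hq₀ : q₀ ∈ B) (h₀ : energyNorm a (p₀ + q₀) = 1) :
    energyNorm a ((energyNorm a (u - w))⁻¹ • (u - w) - (p + q)) ≤
      energyNorm a ((energyNorm a (u - w))⁻¹ • (u - w) - (p₀ + q₀)) := by
  obtain ⟨-, -, h₁, hmax⟩ := h
  have hle := hmax p₀ hp₀ q₀ hq₀ h₀
  rw [residual_eq ha hu, residual_eq ha hu] at hle
  simp only [energyNorm_eq ha] at h₀ h₁ ⊢
  set t := ‖T (u - w)‖ with ht
  have ht0 : 0 < t := norm_pos_iff.2 hne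
  -- On the energy unit sphere the squared distance to the normalized error is a decreasing affine
  -- function of the residual.
  have hsq : ∀ v, ‖T v‖ = 1 → ‖T (t⁻¹ • (u - w) - v)‖ ^ 2 =
      2 - 2 * (t⁻¹ * inner ℝ (T (u - w)) (T v)) := by
    intro v hv
    rw [map_sub, norm_sub_sq_real, hv, map_smul, norm_smul, ← ht, norm_inv,
      Real.norm_of_nonneg ht0.le, inv_mul_cancel₀ ht0.ne', real_inner_smul_left]
    ring
  refine le_of_sq_le_sq ?_ (norm_nonneg _)
  rw [hsq _ h₁, hsq _ h₀]
  have : t⁻¹ * inner ℝ (T (u - w)) (T (p₀ + q₀)) ≤ t⁻¹ * inner ℝ (T (u - w)) (T (p + q)) := by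
    gcongr
  linarith

end Maximizer

/-! ### The energy inner product -/

section Energy

variable {X V W : Type*} [NormedAddCommGroup X] [InnerProductSpace ℝ X]
  [NormedAddCommGroup V] [InnerProductSpace ℝ V] [NormedAddCommGroup W] [InnerProductSpace ℝ W]

/-- The operator `x ↦ (𝓛 x, √δ 𝓑 x)`, which turns the least squares form into an inner product. -/
noncomputable def energyMap (𝓛 : X →L[ℝ] V) (𝓑 : X →L[ℝ] W) (δ : ℝ) : X →L[ℝ] WithLp 2 (V × W) :=
  ((WithLp.prodContinuousLinearEquiv 2 ℝ V W).symm : V × W →L[ℝ] WithLp 2 (V × W)).comp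
    (𝓛.prod (Real.sqrt δ • 𝓑))

theorem lsForm_eq_inner (𝓛 : X →L[ℝ] V) (𝓑 : X →L[ℝ] W) {δ : ℝ} (hδ : 0 ≤ δ) (x y : X) :
    lsForm 𝓛 𝓑 δ x y = inner ℝ (energyMap 𝓛 𝓑 δ x) (energyMap 𝓛 𝓑 δ y) := by
  rw [WithLp.prod_inner_apply]
  change _ = inner ℝ (𝓛 x) (𝓛 y) + inner ℝ (Real.sqrt δ • 𝓑 x) (Real.sqrt δ • 𝓑 y)
  rw [real_inner_smul_left, real_inner_smul_right, ← mul_assoc, Real.mul_self_sqrt hδ, lsForm]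

/-- Each `x` is the unique solution for its own data `(𝓛 x, 𝓑 x)`, so the stability estimate applies
to it. As `δ ≥ 1`, the energy norm bounds both data norms, hence the factor 2. -/
theorem WellPosed.exists_norm_le {𝓛 : X →L[ℝ] V} {𝓑 : X →L[ℝ] W} (h : WellPosed 𝓛 𝓑) {δ : ℝ}
    (hδ : 1 ≤ δ) : ∃ κ : ℝ, 0 < κ ∧ ∀ x, ‖x‖ ≤ κ * ‖energyMap 𝓛 𝓑 δ x‖ := by
  obtain ⟨C, hC, h⟩ := h
  refine ⟨C * 2, by positivity, fun x => ?_⟩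
  obtain ⟨u, -, -, huniq, hu⟩ := h (𝓛 x) (𝓑 x)
  rw [← huniq x rfl rfl] at hu
  have hsq : ‖energyMap 𝓛 𝓑 δ x‖ ^ 2 = ‖𝓛 x‖ ^ 2 + δ * ‖𝓑 x‖ ^ 2 := by
    rw [← real_inner_self_eq_norm_sq, ← lsForm_eq_inner 𝓛 𝓑 (by linarith), lsForm,
      real_inner_self_eq_norm_sq, real_inner_self_eq_norm_sq]
  have h1 : ‖𝓛 x‖ ≤ ‖energyMap 𝓛 𝓑 δ x‖ :=
    le_of_sq_le_sq (by rw [hsq]; nlinarith [sq_nonneg ‖𝓑 x‖]) (norm_nonneg _)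
  have h2 : ‖𝓑 x‖ ≤ ‖energyMap 𝓛 𝓑 δ x‖ :=
    le_of_sq_le_sq (by rw [hsq]; nlinarith [sq_nonneg ‖𝓑 x‖, sq_nonneg ‖𝓛 x‖]) (norm_nonneg _)
  refine hu.trans ?_
  rw [mul_assoc]
  gcongr
  linarith

end Energy

/-! ### The iteration -/

section Iteration

variable {X : Type*} [NormedAddCommGroup X] [InnerProductSpace ℝ X]
  {d : ℕ} {Ω : Set (EuclideanSpace ℝ (Fin d))} {k : ℕ} {S : FunctionSpace Ω k X}
  {a : X → X → ℝ} {F : X → ℝ} {σ : ℝ → ℝ} {Ψ : EuclideanSpace ℝ (Fin d) → ℝ → ℝ} {M : ℕ}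
  {lam : Fin M → ℝ} {φσ φΨ uσ uΨ : ℕ → X} {i : ℕ}

theorem partSpan_le {u₀ v₀ : X} {φ : ℕ → X} {U : Submodule ℝ X} (hv : v₀ ∈ U)
    (hφ : ∀ j < i, φ (j + 1) ∈ U) : partSpan a u₀ v₀ φ i ≤ U := by
  refine Submodule.span_le.2 (insert_subset (U.smul_mem _ hv) ?_)
  rintro _ ⟨j, ⟨hj1, hji⟩, rfl⟩
  obtain ⟨j, rfl⟩ := Nat.exists_eq_add_of_le' hj1
  exact hφ j (by omega)

/-- All generators of the span are networks, which are `C^k`, or multiples of the initial regular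
part, and `regularPart` is by definition the carrier of a closed subspace. -/
theorem IsIteration.regular_mem_regularPart (hσ : ContDiff ℝ k σ)
    (h : IsIteration S a F σ Ψ lam φσ φΨ uσ uΨ i) : uσ i ∈ S.regularPart := by
  rcases Nat.eq_zero_or_pos i with rfl | hi
  · exact h.regular_zero
  · refine partSpan_le (U := S.smoothSubmodule.topologicalClosure) h.regular_zero (fun j hj => ?_)
      (h.regular_mem i hi le_rfl)
    obtain ⟨n, C₁, C₂, -, hb⟩ := h.isBasisFunction j hj
    exact subset_closure (FunctionSpace.networkSet_subset_smoothSubmodule hσ n C₁ hb.1)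

theorem IsIteration.singular_mem_range {ψ : Fin M → X}
    (hψ : ∀ j, S.Represents (ψ j) fun x => Ψ x (lam j))
    (h : IsIteration S a F σ Ψ lam φσ φΨ uσ uΨ i) :
    uΨ i ∈ LinearMap.range (Fintype.linearCombination ℝ ψ) := by
  have hK := FunctionSpace.knowledgeSet_eq hψ
  have h0 : uΨ 0 ∈ (LinearMap.range (Fintype.linearCombination ℝ ψ) : Set X) :=
    hK ▸ h.singular_zero
  rcases Nat.eq_zero_or_pos i with rfl | hi
  · exact h0
  · refine partSpan_le h0 (fun j hj => ?_) (h.singular_mem i hi le_rfl)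
    obtain ⟨n, C₁, C₂, -, hb⟩ := h.isBasisFunction j hj
    have h1 := FunctionSpace.knowledgeSetBounded_subset C₂ hb.2.1
    rw [hK] at h1
    exact h1

end Iteration

/-- Elements of the range of a linear map on a finite dimensional space have preimages of
controlled norm. -/
theorem exists_norm_preimage_le {P X : Type*} [NormedAddCommGroup P] [NormedSpace ℝ P]
    [FiniteDimensional ℝ P] [NormedAddCommGroup X] [NormedSpace ℝ X] (Φ : P →ₗ[ℝ] X) :
    ∃ D : ℝ, 0 ≤ D ∧ ∀ x ∈ LinearMap.range Φ, ∃ c, Φ c = x ∧ ‖c‖ ≤ D * ‖x‖ := by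
  obtain ⟨g, hg⟩ := Φ.rangeRestrict.exists_rightInverse_of_surjective Φ.range_rangeRestrict
  refine ⟨‖LinearMap.toContinuousLinearMap g‖, ContinuousLinearMap.opNorm_nonneg _, fun x hx => ⟨g ⟨x, hx⟩, ?_, ?_⟩⟩
  · exact congrArg Subtype.val (LinearMap.congr_fun hg ⟨x, hx⟩)
  · exact (LinearMap.toContinuousLinearMap g).le_opNorm ⟨x, hx⟩

/-! ### Approximation of the normalized error -/

section NormalizedError

variable {X H : Type*} [NormedAddCommGroup X] [InnerProductSpace ℝ X] [CompleteSpace X]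
  [NormedAddCommGroup H] [InnerProductSpace ℝ H]
  {d : ℕ} {Ω : Set (EuclideanSpace ℝ (Fin d))} {k : ℕ} {S : FunctionSpace Ω k X}

/-- The normalized error can be approximated by admissible elements of norm one; the bound for the
knowledge-based part is universal, architecture and bound for the network part depend on the
regular part of the error only. -/
theorem exists_bounds_normalized_error (hΩb : Bornology.IsBounded Ω) {σ : ℝ → ℝ}
    (hσ : ContDiff ℝ k σ) (hσp : ¬ ∃ P : Polynomial ℝ, ∀ t : ℝ, σ t = P.eval t)
    {Ψ : EuclideanSpace ℝ (Fin d) → ℝ → ℝ} {M : ℕ} {lam : Fin M → ℝ} {ψ : Fin M → X}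
    (hψ : ∀ j, S.Represents (ψ j) fun x => Ψ x (lam j)) {L : ℕ} (hL : 1 ≤ L)
    (T : X →L[ℝ] H) {κ : ℝ} (hκ : 0 < κ) (hT : ∀ x, ‖x‖ ≤ κ * ‖T x‖) :
    ∃ C₂ : ℝ, 0 < C₂ ∧ ∀ (ε : ℝ) (e₁ : X), ∃ (n : List ℕ) (C₁ : ℝ),
      n.length = L ∧ (∀ m ∈ n, 0 < m) ∧ 0 < C₁ ∧ (0 < ε → e₁ ∈ S.regularPart →
        ∀ e₂ ∈ LinearMap.range (Fintype.linearCombination ℝ ψ), e₁ + e₂ ≠ 0 →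
          ∃ p ∈ S.networkSet σ n C₁, ∃ q ∈ S.knowledgeSetBounded Ψ lam C₂, ‖T (p + q)‖ = 1 ∧
            ‖T (‖T (e₁ + e₂)‖⁻¹ • (e₁ + e₂) - (p + q))‖ ≤ ε) := by
  obtain ⟨c, hc, hdec⟩ := exists_stable_decomposition (R := S.smoothSubmodule.topologicalClosure)
    (K := LinearMap.range (Fintype.linearCombination ℝ ψ))
    S.smoothSubmodule.isClosed_topologicalClosure
  obtain ⟨D, hD, hpre⟩ := exists_norm_preimage_le (Fintype.linearCombination ℝ ψ)
  -- `D` bounds coefficients by norms, `(1 + c) * κ` bounds the knowledge part of the normalized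
  -- error, and `2` pays for the final normalization.
  refine ⟨D * (2 * ((1 + c) * κ)) + ‖lam‖ + 1, by positivity, fun ε e₁ => ?_⟩
  by_cases hεe : 0 < ε ∧ e₁ ∈ S.regularPart
  swap
  · refine ⟨List.replicate L 1, 1, by simp, fun m hm => ?_, one_pos, fun h1 h2 => ?_⟩
    · rw [List.eq_of_mem_replicate hm]; exact one_pos
    · exact absurd ⟨h1, h2⟩ hεe
  obtain ⟨hε, he₁⟩ := hεe
  obtain ⟨e, he, hed⟩ := hdec e₁ he₁
  set η := min (ε / 2) (1 / 2) with hη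
  have hη0 : 0 < η := by positivity
  have hη1 : η ≤ 1 / 2 := min_le_right _ _
  have hη2 : 2 * η ≤ ε := by linarith [min_le_left (ε / 2) (1 / 2 : ℝ)]
  -- The direction of `e` is approximated (it reads `0` if `e = 0`). The factor `‖e‖ / s` needed
  -- later depends on `e₂`, but is at most `c * κ`, which fixes the accuracy in advance.
  obtain ⟨n, N, w, hnL, hn0, hw, hvw⟩ := FunctionSpace.exists_network_norm_sub_le (S := S) hΩb hσ
    hσp hL (v := ‖e‖⁻¹ • e) (Submodule.smul_mem _ _ he)
    (ε := η / (‖T‖ * (c * κ) + 1)) (by positivity)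
  -- The final network is `N` with output scaled by `t⁻¹ * (‖e‖ / s) ≤ 2 * (c * κ)`.
  refine ⟨n, (2 * (c * κ) + 1) * N.size + 1, hnL, hn0, ?_, fun _ _ e₂ he₂ hne => ?_⟩
  · have := N.size_nonneg
    positivity
  obtain ⟨hK, hbound⟩ := hed e₂ he₂
  set v := e₁ + e₂ with hv
  set s := ‖T v‖ with hs
  have hs0 : 0 < s := by
    have h1 := hT v
    have h2 : 0 < ‖v‖ := norm_pos_iff.2 hne
    by_contra hcon
    have : κ * s ≤ 0 := mul_nonpos_of_nonneg_of_nonpos hκ.le (not_lt.1 hcon)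
    linarith
  have hvs : ‖v‖ / s ≤ κ := by rw [div_le_iff₀ hs0]; exact hT v
  have hes : ‖e‖ / s ≤ c * κ := by
    calc ‖e‖ / s ≤ c * ‖v‖ / s := by gcongr
      _ = c * (‖v‖ / s) := by ring
      _ ≤ c * κ := by gcongr
  set p₁ := (‖e‖ / s) • w with hp₁
  set q₁ := s⁻¹ • (v - e) with hq₁
  have hφ : ‖T (s⁻¹ • v)‖ = 1 := by
    rw [map_smul, norm_smul, norm_inv, Real.norm_of_nonneg hs0.le, ← hs, inv_mul_cancel₀ hs0.ne']
  have herr : ‖T (s⁻¹ • v) - T (p₁ + q₁)‖ ≤ η := by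
    have h1 : s⁻¹ • v - (p₁ + q₁) = (‖e‖ / s) • (‖e‖⁻¹ • e - w) := by
      have h2 : (‖e‖ / s) • ‖e‖⁻¹ • e = s⁻¹ • e := by
        rcases eq_or_ne e 0 with h0 | h0
        · simp [h0]
        · have : ‖e‖ ≠ 0 := norm_ne_zero_iff.2 h0
          rw [smul_smul]
          congr 1
          field_simp
      rw [smul_sub, h2, hp₁, hq₁, smul_sub]
      abel
    rw [← map_sub, h1]
    calc ‖T ((‖e‖ / s) • (‖e‖⁻¹ • e - w))‖
        ≤ ‖T‖ * ‖(‖e‖ / s) • (‖e‖⁻¹ • e - w)‖ := T.le_opNorm _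
      _ = ‖T‖ * (‖e‖ / s * ‖‖e‖⁻¹ • e - w‖) := by
          rw [norm_smul, Real.norm_of_nonneg (by positivity)]
      _ ≤ ‖T‖ * (c * κ * (η / (‖T‖ * (c * κ) + 1))) := by gcongr
      _ = ‖T‖ * (c * κ) * (η / (‖T‖ * (c * κ) + 1)) := by ring
      _ ≤ (‖T‖ * (c * κ) + 1) * (η / (‖T‖ * (c * κ) + 1)) := by gcongr; linarith
      _ = η := by field_simp
  set t := ‖T (p₁ + q₁)‖ with ht
  have ht2 : 1 / 2 ≤ t := by
    have h1 := (norm_sub_norm_le (T (s⁻¹ • v)) (T (p₁ + q₁))).trans herr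
    rw [hφ, ← ht] at h1
    linarith
  have ht0 : 0 < t := by linarith
  have hti : t⁻¹ ≤ 2 := by
    rw [inv_le_comm₀ ht0 two_pos]
    linarith
  have hsum : t⁻¹ • p₁ + t⁻¹ • q₁ = t⁻¹ • (p₁ + q₁) := (smul_add _ _ _).symm
  refine ⟨t⁻¹ • p₁, ?_, t⁻¹ • q₁, ?_, ?_, ?_⟩
  · refine ⟨N.scale (t⁻¹ * (‖e‖ / s)), ?_, ?_⟩
    · have hτ : |t⁻¹ * (‖e‖ / s)| ≤ 2 * (c * κ) := by
        rw [abs_of_nonneg (by positivity)]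
        gcongr
      linarith [N.size_scale_le hτ]
    · have h1 := hw.smul (t⁻¹ * (‖e‖ / s))
      rw [hp₁, smul_smul]
      convert h1 using 1
      ext x
      rw [Network.eval_scale]
      rfl
  · rw [FunctionSpace.knowledgeSetBounded_eq hψ]
    obtain ⟨b, hb, hbn⟩ := hpre (t⁻¹ • q₁)
      (Submodule.smul_mem _ _ (Submodule.smul_mem _ _ hK))
    refine ⟨b, ?_, hb⟩
    rw [mem_closedBall_zero_iff]
    have h1 : ‖v - e‖ ≤ (1 + c) * ‖v‖ := by linarith [norm_sub_le v e]
    have h2 : ‖t⁻¹ • q₁‖ ≤ 2 * ((1 + c) * κ) := by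
      rw [hq₁, norm_smul, norm_smul, Real.norm_of_nonneg (by positivity),
        Real.norm_of_nonneg (by positivity)]
      calc t⁻¹ * (s⁻¹ * ‖v - e‖) ≤ 2 * (s⁻¹ * ((1 + c) * ‖v‖)) := by gcongr
        _ = 2 * ((1 + c) * (‖v‖ / s)) := by ring
        _ ≤ 2 * ((1 + c) * κ) := by gcongr
    have h3 : D * ‖t⁻¹ • q₁‖ ≤ D * (2 * ((1 + c) * κ)) := by gcongr
    linarith
  · rw [hsum, map_smul, norm_smul, norm_inv, Real.norm_of_nonneg ht0.le, ← ht,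
      inv_mul_cancel₀ ht0.ne']
  · rw [hsum, map_sub, map_smul T t⁻¹]
    exact (norm_sub_normalize_le hφ herr (by linarith)).trans hη2

end NormalizedError

end XGNN

/-! ### The proposition. -/

theorem mainTheorem2 {d k : ℕ} {Ω : Set (EuclideanSpace ℝ (Fin d))}
    (hΩ : IsOpen Ω) (hΩb : Bornology.IsBounded Ω)
    {X V W : Type*}
    [NormedAddCommGroup X] [InnerProductSpace ℝ X] [CompleteSpace X]
    [NormedAddCommGroup V] [InnerProductSpace ℝ V] [CompleteSpace V]
    [NormedAddCommGroup W] [InnerProductSpace ℝ W] [CompleteSpace W]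
    (S : XGNN.FunctionSpace Ω k X)
    (𝓛 : X →L[ℝ] V) (𝓑 : X →L[ℝ] W) (hwp : XGNN.WellPosed 𝓛 𝓑)
    (δ : ℝ) (hδ : 1 ≤ δ)
    (σ : ℝ → ℝ) (hσ : ContDiff ℝ k σ)
    (hσp : ¬ ∃ P : Polynomial ℝ, ∀ t : ℝ, σ t = P.eval t)
    (Ψ : EuclideanSpace ℝ (Fin d) → ℝ → ℝ) {M : ℕ} (lam : Fin M → ℝ)
    (hlam : ∀ j, lam j ∈ S.admissible Ψ)
    (L : ℕ) (hL : 1 ≤ L) :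
    ∃ (n : ℝ → X → List ℕ) (C₁ C₂ : ℝ → X → ℝ), ∀ ε : ℝ, 0 < ε →
      (∀ e : X, (n ε e).length = L ∧ (∀ w ∈ n ε e, 0 < w) ∧ 0 < C₁ ε e ∧ 0 < C₂ ε e) ∧
      ∀ (f : V) (g : W) (u u_inf u_Psi : X),
        (∀ v : X, XGNN.lsForm 𝓛 𝓑 δ u v = XGNN.lsFunctional 𝓛 𝓑 δ f g v) →
        u = u_inf + u_Psi → u_inf ∈ S.regularPart → u_Psi ∈ S.knowledgeSet Ψ lam →
        ∀ (φσ φΨ uσ uΨ : ℕ → X) (i : ℕ),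
          XGNN.IsIteration S (XGNN.lsForm 𝓛 𝓑 δ) (XGNN.lsFunctional 𝓛 𝓑 δ f g) σ Ψ lam
            φσ φΨ uσ uΨ i →
          u ≠ uσ i + uΨ i →
          (∃ p q : X, XGNN.IsBasisFunction (XGNN.lsForm 𝓛 𝓑 δ) (XGNN.lsFunctional 𝓛 𝓑 δ f g)
            (uσ i + uΨ i)
            (S.networkSet σ (n ε (u_inf - uσ i)) (C₁ ε (u_inf - uσ i)))
            (S.knowledgeSetBounded Ψ lam (C₂ ε (u_Psi - uΨ i))) p q) ∧
          ∀ p q : X, XGNN.IsBasisFunction (XGNN.lsForm 𝓛 𝓑 δ) (XGNN.lsFunctional 𝓛 𝓑 δ f g)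
            (uσ i + uΨ i)
            (S.networkSet σ (n ε (u_inf - uσ i)) (C₁ ε (u_inf - uσ i)))
            (S.knowledgeSetBounded Ψ lam (C₂ ε (u_Psi - uΨ i))) p q →
            XGNN.energyNorm (XGNN.lsForm 𝓛 𝓑 δ)
              ((XGNN.energyNorm (XGNN.lsForm 𝓛 𝓑 δ) (u - (uσ i + uΨ i)))⁻¹ •
                (u - (uσ i + uΨ i)) - (p + q)) ≤ ε := by
  choose ψ hψ using hlam
  obtain ⟨κ, hκ, hT⟩ := hwp.exists_norm_le hδ
  obtain ⟨C₂, hC₂, h⟩ := XGNN.exists_bounds_normalized_error (S := S) hΩb hσ hσp hψ hL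
    (XGNN.energyMap 𝓛 𝓑 δ) hκ hT
  choose n C₁ hnL hn0 hC₁ happ using h
  have ha := XGNN.lsForm_eq_inner 𝓛 𝓑 (zero_le_one.trans hδ)
  -- After the stable decomposition one constant bounds the knowledge coefficients for all `ε` and
  -- all errors.
  refine ⟨n, C₁, fun _ _ => C₂, fun ε hε => ⟨fun e => ⟨hnL ε e, hn0 ε e, hC₁ ε e, hC₂⟩, ?_⟩⟩
  intro f g u u_inf u_Psi hu huS huinf huPsi φσ φΨ uσ uΨ i hit hne
  have he₁ : u_inf - uσ i ∈ S.regularPart :=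
    S.smoothSubmodule.topologicalClosure.sub_mem huinf (hit.regular_mem_regularPart hσ)
  rw [XGNN.FunctionSpace.knowledgeSet_eq hψ] at huPsi
  have he₂ := Submodule.sub_mem _ huPsi (hit.singular_mem_range hψ)
  have hsum : u_inf - uσ i + (u_Psi - uΨ i) = u - (uσ i + uΨ i) := by
    rw [huS]
    abel
  have hne' : u - (uσ i + uΨ i) ≠ 0 := sub_ne_zero.2 hne
  obtain ⟨p, hp, q, hq, hpq, herr⟩ := happ ε _ hε he₁ _ he₂ (hsum ▸ hne')
  rw [hsum] at herr
  rw [← XGNN.energyNorm_eq ha] at hpq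
  have hTne : XGNN.energyMap 𝓛 𝓑 δ (u - (uσ i + uΨ i)) ≠ 0 := fun h0 => hne' <| by
    have := hT (u - (uσ i + uΨ i))
    rw [h0, norm_zero, mul_zero] at this
    exact norm_le_zero_iff.1 this
  refine ⟨XGNN.exists_isBasisFunction ha hu (XGNN.FunctionSpace.isCompact_networkSet hΩb hσ _ _) ?_
    ⟨p, hp, q, hq, hpq⟩, fun p' q' h' => ?_⟩
  · rw [XGNN.FunctionSpace.knowledgeSetBounded_eq hψ]
    exact (isCompact_closedBall _ _).image
      (Fintype.linearCombination ℝ ψ).continuous_of_finiteDimensional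
  · refine (h'.energyNorm_sub_le ha hu hTne hp hq hpq).trans ?_
    rw [XGNN.energyNorm_eq ha, XGNN.energyNorm_eq ha]
    exact herr
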